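/- Let $\mathbb S^2\subset\mathbb R^3$ be the unit sphere with coordinates $(x,y,z)$ and surface measure, and let $\nabla$, $\operatorname{div}$, $\Delta$ be its surface gradient, divergence and Laplacian. For a vector field $\mathbf u$ tangent to $\mathbb S^2$ let $\mathbf u^\perp$ be its counterclockwise rotation by $\pi/2$, and put $\nabla^\perp f:=(\nabla f)^\perp$; let $\operatorname{curl}$ be the scalar curl with $\operatorname{curl}\nabla^\perp f=\Delta f$ and $\operatorname{curl}(\mathbf u^\perp)=\operatorname{div}\mathbf u$ (all derivatives of square-integrable objects are weak). Let $\Delta^{-1}f$ denote the solution of $\Delta\chi=f$ with zero mean over $\mathbb S^2$, and for a square-integrable tangent vector field $\mathbf u$ put $$\mathcal L[\mathbf u]:=\nabla^\perp\Delta^{-1}\operatorname{curl}(z\,\mathbf u^\perp).$$ Let $\Pi$ be the $L^2$-orthogonal projection onto the null space of $\mathcal L$ within divergence-free fields, $\{\mathbf v\in L^2:\operatorname{div}\mathbf v=0,\ \mathcal L[\mathbf v]=0\}$. For a zero-mean function $\Psi=\sum_{l\ge1}\sum_{m=-l}^{l}\psi_l^mY_l^m$, where the $Y_l^m$ are the $L^2$-normalized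 spherical harmonics, and for a vector field with Hodge decomposition $\mathbf u=\nabla\Phi+\nabla^\perp\Psi$, $\int_{\mathbb S^2}\Phi=\int_{\mathbb S^2}\Psi=0$, let $$\|\Psi\|_{H^s}:=\Big(\sum_{l=1}^\infty\sum_{m=-l}^{l}(1+l)^{2s}|\psi_l^m|^2\Big)^{1/2},\qquad \|\mathbf u\|_{H^s}:=\big(\|\Phi\|_{H^{s+1}}^2+\|\Psi\|_{H^{s+1}}^2\big)^{1/2},$$ with values in $[0,\infty]$; $\mathbf u\in H^s$ means $\|\mathbf u\|_{H^s}<\infty$. **Theorem.** For every real $k\ge0$ and every divergence-free vector field $\mathbf u\in H^k(\mathbb S^2)$, $$\|\mathbf u-\Pi\mathbf u\|_{H^k}\le\|\mathcal L[\mathbf u-\Pi\mathbf u]\|_{H^{k+2}}=\|\mathcal L[\mathbf u]\|_{H^{k+2}},$$ where the two norms on the right may be $+\infty$. -/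

import Mathlib

open MeasureTheory Filter Topology
open scoped ENNReal ContDiff InnerProductSpace

noncomputable section

namespace SphereFlow

/-! ### The unit sphere -/

/-- Euclidean space `ℝ³`, with coordinates `x = p 0`, `y = p 1`, `z = p 2`. -/
abbrev E3 : Type := EuclideanSpace ℝ (Fin 3)

/-- The unit sphere `𝕊²` centred at the origin of `ℝ³`. -/
abbrev S2 : Type := Metric.sphere (0 : E3) 1

/-- The surface area measure of `𝕊²` (total mass `4π`). -/
abbrev area : Measure S2 := (volume : Measure E3).toSphere

/-- Real square-integrable functions on `𝕊²`. -/
abbrev ScalarL2 : Type := Lp ℝ 2 area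

/-- Square-integrable `ℝ³`-valued fields on `𝕊²`; a vector field on `𝕊²` is such a field which is
tangent to `𝕊²`, see `IsTangent`. -/
abbrev FieldL2 : Type := Lp E3 2 area

/-- `u` is tangent to the sphere at (almost) every point. -/
def IsTangent (u : FieldL2) : Prop := ∀ᵐ p ∂area, ⟪u p, (p : E3)⟫_ℝ = 0

/-- The cross product of `ℝ³`. -/
def cross (a b : E3) : E3 := WithLp.toLp 2 (crossProduct a.ofLp b.ofLp)

/-- The counterclockwise (seen from outside the sphere) rotation by `π/2` of tangent vectors,
`u^⊥(p) = p × u(p)`. -/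
def perp (u : S2 → E3) : S2 → E3 := fun p => cross (p : E3) (u p)

/-! ### Smooth functions and their derivatives -/

/-- Smooth functions on the sphere, given as (restrictions of) smooth functions on `ℝ³`: every
smooth function on `𝕊²` is such a restriction, and everything below depends on the restriction
only. -/
abbrev TestFun : Type := {f : E3 → ℝ // ContDiff ℝ ∞ f}

/-- The surface gradient `∇f` of a smooth function: the tangential part of the gradient in `ℝ³`. -/
def surfGrad (f : TestFun) : S2 → E3 := fun p =>
  gradient f.1 (p : E3) - ⟪gradient f.1 (p : E3), (p : E3)⟫_ℝ • (p : E3)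

/-- The rotated surface gradient `∇^⊥ f = (∇f)^⊥` of a smooth function. -/
def surfRotGrad (f : TestFun) : S2 → E3 := perp (surfGrad f)

/-! ### Derivatives of square-integrable objects -/

/-- `χ ∈ H¹(𝕊²)` and `g = ∇χ`, where `H¹` is the completion of the smooth functions: `(χ, g)` is
the `L²` limit of pairs `(f, ∇f)` with `f` smooth. -/
def HasGrad (χ : ScalarL2) (g : FieldL2) : Prop :=
  ∃ F : ℕ → TestFun,
    Tendsto (fun n => eLpNorm (fun p : S2 => (F n).1 p - χ p) 2 area) atTop (𝓝 0) ∧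
    Tendsto (fun n => eLpNorm (fun p : S2 => surfGrad (F n) p - g p) 2 area) atTop (𝓝 0)

/-- `χ ∈ H¹(𝕊²)` and `g = ∇^⊥ χ`. -/
def HasRotGrad (χ : ScalarL2) (g : FieldL2) : Prop :=
  ∃ F : ℕ → TestFun,
    Tendsto (fun n => eLpNorm (fun p : S2 => (F n).1 p - χ p) 2 area) atTop (𝓝 0) ∧
    Tendsto (fun n => eLpNorm (fun p : S2 => surfRotGrad (F n) p - g p) 2 area) atTop (𝓝 0)

/-- The divergence of a vector field, as a distribution: `⟨div u, f⟩ = -∫ u · ∇f`. -/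
def divDist (u : S2 → E3) (f : TestFun) : ℝ := -∫ p, ⟪u p, surfGrad f p⟫_ℝ ∂area

/-- The (scalar) curl of a vector field, as a distribution: `⟨curl u, f⟩ = -∫ u · ∇^⊥ f`. With the
signs used here, `curl ∇^⊥ f = div ∇f = Δf` and `curl (u^⊥) = div u`. -/
def curlDist (u : S2 → E3) (f : TestFun) : ℝ := -∫ p, ⟪u p, surfRotGrad f p⟫_ℝ ∂area

/-- `u` is divergence free in the sense of distributions. -/
def IsDivFree (u : FieldL2) : Prop := ∀ f : TestFun, divDist u f = 0

/-- `χ = Δ⁻¹ T` for a distribution `T`: `χ ∈ H¹(𝕊²)` has zero global mean, and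
`Δχ = div ∇χ = T` in the sense of distributions. -/
def IsInvLaplacian (T : TestFun → ℝ) (χ : ScalarL2) : Prop :=
  ∫ p, χ p ∂area = 0 ∧ ∃ g : FieldL2, HasGrad χ g ∧ ∀ f : TestFun, divDist g f = T f

open Classical in
/-- The inverse Laplacian `Δ⁻¹ T` with zero global mean (and `0` if there is none). -/
def invLaplacian (T : TestFun → ℝ) : ScalarL2 :=
  if h : ∃ χ, IsInvLaplacian T χ then h.choose else 0

open Classical in
/-- The rotated gradient `∇^⊥ χ` of `χ ∈ H¹(𝕊²)` (and `0` if `χ` is not in `H¹`). -/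
def rotGrad (χ : ScalarL2) : FieldL2 :=
  if h : ∃ g, HasRotGrad χ g then h.choose else 0

/-! ### The operator `L` and the projection onto its null space -/

/-- `L[u] = ∇^⊥ Δ⁻¹ curl (z u^⊥)`. -/
def opL (u : FieldL2) : FieldL2 :=
  rotGrad (invLaplacian (curlDist (fun p => (p : E3) 2 • perp u p)))

/-- The null space of `L` within the divergence-free square-integrable vector fields. -/
def nullL : Set FieldL2 := {v | IsTangent v ∧ IsDivFree v ∧ opL v = 0}

/-- The `L²`-orthogonal projection onto the null space of `L`. (That null space is a closed linear
subspace, so it equals the closure of its span; the latter is a closed subspace by construction.) -/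
def projNull (u : FieldL2) : FieldL2 :=
  (Submodule.span ℝ nullL).topologicalClosure.starProjection u

/-! ### Spherical harmonics and Sobolev norms -/

/-- The spherical harmonic `Y_l^m = N_l^m e^{imφ} Q_l^m(cos θ)` for `0 ≤ m ≤ l`, where
`N_l^m = √((2l+1)/(4π) · (l-m)!/(l+m)!)` and
`Q_l^m(z) = (2^l l!)⁻¹ (1-z²)^{m/2} (d/dz)^{l+m} (1-z²)^l`; on the sphere
`e^{imφ} (1-z²)^{m/2} = (x+iy)^m`. -/
def sphHarmNat (l m : ℕ) (p : S2) : ℂ :=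
  (Real.sqrt ((2 * l + 1) / (4 * Real.pi) * ((l - m).factorial / (l + m).factorial)) : ℝ) *
    (((p : E3) 0 : ℂ) + ((p : E3) 1 : ℂ) * Complex.I) ^ m *
    ((1 / (2 ^ l * l.factorial) *
      (Polynomial.derivative^[l + m]
        ((1 - Polynomial.X ^ 2) ^ l : Polynomial ℝ)).eval ((p : E3) 2) : ℝ) : ℂ)

/-- The spherical harmonic `Y_l^m` of degree `l` and order `m`, `-l ≤ m ≤ l`; for negative order,
`Y_l^{-m}` is `(-1)^m` times the complex conjugate of `Y_l^m`, which is also what the formula for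
`m ≥ 0` gives when it is read with a negative `m`. -/
def sphHarm (l : ℕ) (m : ℤ) (p : S2) : ℂ :=
  if 0 ≤ m then sphHarmNat l m.natAbs p
  else (-1) ^ m.natAbs * (starRingEnd ℂ) (sphHarmNat l m.natAbs p)

/-- The spherical-harmonic coefficient `ψ_l^m` of `Ψ`, so that `Ψ = ∑ ψ_l^m Y_l^m`. -/
def coeff (Ψ : ScalarL2) (l : ℕ) (m : ℤ) : ℂ :=
  ∫ p, (starRingEnd ℂ) (sphHarm l m p) * ((Ψ p : ℝ) : ℂ) ∂area

/-- The norm `‖Ψ‖_{H^s} = (∑_{l ≥ 1} ∑_{|m| ≤ l} (1+l)^{2s} |ψ_l^m|²)^{1/2}` of a function `Ψ` with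
zero mean; it is `∞` if `Ψ` is not in `H^s`. -/
def scalarNorm (s : ℝ) (Ψ : ScalarL2) : ℝ≥0∞ :=
  (∑' l : ℕ+, ∑ m ∈ Finset.Icc (-((l : ℕ) : ℤ)) ((l : ℕ) : ℤ),
    (1 + ((l : ℕ) : ℝ≥0∞)) ^ (2 * s) * ‖coeff Ψ l m‖ₑ ^ 2) ^ (1 / 2 : ℝ)

/-- The Hodge decomposition `u = ∇Φ + ∇^⊥ Ψ` with `∫ Φ = ∫ Ψ = 0`. -/
def IsHodge (u : FieldL2) (Φ Ψ : ScalarL2) : Prop :=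
  ∫ p, Φ p ∂area = 0 ∧ ∫ p, Ψ p ∂area = 0 ∧
    ∃ a b : FieldL2, HasGrad Φ a ∧ HasRotGrad Ψ b ∧ u = a + b

/-- The norm `‖u‖_{H^s} = (‖Φ‖²_{H^{s+1}} + ‖Ψ‖²_{H^{s+1}})^{1/2}` of a vector field with Hodge
decomposition `u = ∇Φ + ∇^⊥ Ψ`; it is `∞` if `u` is not in `H^s`. The decomposition being unique,
the infimum is over one pair. -/
def fieldNorm (s : ℝ) (u : FieldL2) : ℝ≥0∞ :=
  ⨅ (Φ : ScalarL2) (Ψ : ScalarL2) (_ : IsHodge u Φ Ψ),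
    (scalarNorm (s + 1) Φ ^ 2 + scalarNorm (s + 1) Ψ ^ 2) ^ (1 / 2 : ℝ)

end SphereFlow

end

/-!
A divergence-free field with a Hodge decomposition is a rotated gradient `u = ∇^⊥ Ψ`, and for such
a field `curl (z u^⊥) = div (z u) = u · ∇z` is the derivative `D_z Ψ` along the rotations about the
`z`-axis. Hence `L` acts diagonally on the spherical-harmonic coefficients of the stream function:
it multiplies them by `i m / (l (l + 1))` (`HasRotGrad.rpair_opL`; the sign of `i m` depends on
whether the coefficients are taken with a complex conjugation). So the null space of `L` consists
of the zonal flows, `m = 0`; the projection removes exactly the coefficients of order `m = 0`; and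
for `m ≠ 0` the factor `|m| / (l (l + 1))` is at least `(1 + l)⁻²`, which is the estimate
(`weight_mul_enorm_le`). The equality holds because `L` does not see the coefficients of order `0`.

The supporting facts on the sphere are obtained as follows.

* The area is invariant under rotations, so the derivatives `D_i` along the rotations about the
  axes have integral zero (`integral_rotDeriv`). As `Δ = ∑ D_i²`, this gives Green's formula
  (`integral_inner_surfGrad`), and also the orthogonality of gradients and rotated gradients.
* The functions `(x + iy)^m q(z)` with `q` the `(l + m)`-th derivative of `(1 - z²)^l` are
  eigenfunctions of `Δ` (`lap_harm`, from the Legendre differential equation), and they are complete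
  (`eq_zero_of_cpair_harm`, by the Stone-Weierstrass theorem).
* The orthogonality of eigenfunctions and completeness give the Poincaré inequality
  (`norm_toL2_le_norm_gradL2`), whence every limit of gradients is a gradient. Therefore the inverse
  Laplacian in `L` exists for every square-integrable field (`exists_isInvLaplacian`).
* A general element `n` of the null space is only known to be tangent and divergence free with
  `n · ∇z = 0`. It is orthogonal to `∇^⊥ ((x + iy)^m q(z))` for `m ≥ 1`, because up to radial and
  vertical fields the latter is a gradient (`rotGrad_zonal_identity`). This identifies the
  projection (`sub_projNull`).
-/

noncomputable section

namespace SphereFlow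

/-! ### The rotation group acting on the sphere -/

/-- The `i`-th standard basis vector of `ℝ³`. -/
def basisVec (i : Fin 3) : E3 := EuclideanSpace.single i 1

lemma basisVec_apply (i j : Fin 3) : basisVec i j = if j = i then 1 else 0 := by
  simp [basisVec]

lemma cross_apply_zero (a b : E3) : cross a b 0 = a 1 * b 2 - a 2 * b 1 := by
  simp [cross, crossProduct]

lemma cross_apply_one (a b : E3) : cross a b 1 = a 2 * b 0 - a 0 * b 2 := by
  simp [cross, crossProduct]

lemma cross_apply_two (a b : E3) : cross a b 2 = a 0 * b 1 - a 1 * b 0 := by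
  simp [cross, crossProduct]

lemma inner_eq_sum (a b : E3) : ⟪a, b⟫_ℝ = a 0 * b 0 + a 1 * b 1 + a 2 * b 2 := by
  simp [PiLp.inner_apply, Fin.sum_univ_three]
  ring

lemma ext_E3 {a b : E3} (h0 : a 0 = b 0) (h1 : a 1 = b 1) (h2 : a 2 = b 2) : a = b := by
  ext i
  fin_cases i <;> assumption

lemma sq_add_sq_add_sq (p : S2) :
    (p : E3) 0 ^ 2 + (p : E3) 1 ^ 2 + (p : E3) 2 ^ 2 = 1 := by
  have h : ⟪(p : E3), (p : E3)⟫_ℝ = 1 := by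
    rw [real_inner_self_eq_norm_sq]
    simp
  rw [inner_eq_sum] at h
  linarith

/-- The cross product as a continuous linear map in its second argument. -/
def crossCLM (a : E3) : E3 →L[ℝ] E3 :=
  LinearMap.toContinuousLinearMap
    { toFun := cross a
      map_add' := fun x y => by simp [cross]
      map_smul' := fun c x => by simp [cross] }

@[simp] lemma crossCLM_apply (a b : E3) : crossCLM a b = cross a b := rfl

/-- The rotation by the angle `t` about the unit vector `a` (Rodrigues' formula). -/
def rotAbout (a : E3) (t : ℝ) : E3 →L[ℝ] E3 :=
  ContinuousLinearMap.id ℝ E3 + Real.sin t • crossCLM a +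
    (1 - Real.cos t) • (crossCLM a ∘L crossCLM a)

lemma rotAbout_apply (a : E3) (t : ℝ) (p : E3) :
    rotAbout a t p = p + Real.sin t • cross a p + (1 - Real.cos t) • cross a (cross a p) := rfl

lemma norm_rotAbout {a : E3} (ha : ‖a‖ = 1) (t : ℝ) (p : E3) : ‖rotAbout a t p‖ = ‖p‖ := by
  have h1 : a 0 * a 0 + a 1 * a 1 + a 2 * a 2 = 1 := by
    rw [← inner_eq_sum, real_inner_self_eq_norm_sq, ha, one_pow]
  have h2 := Real.sin_sq_add_cos_sq t
  rw [← sq_eq_sq₀ (norm_nonneg _) (norm_nonneg _), ← real_inner_self_eq_norm_sq,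
    ← real_inner_self_eq_norm_sq, inner_eq_sum, inner_eq_sum, rotAbout_apply]
  simp only [PiLp.add_apply, PiLp.smul_apply, smul_eq_mul, cross_apply_zero, cross_apply_one,
    cross_apply_two]
  generalize Real.sin t = s at *
  generalize Real.cos t = c at *
  generalize a 0 = a0 at *
  generalize a 1 = a1 at *
  generalize a 2 = a2 at *
  generalize p 0 = x
  generalize p 1 = y
  generalize p 2 = z
  -- `S = |a × p|²`; the difference of the squared norms is `S (s² + c² - 1)` up to `|a|² - 1`
  linear_combination
    ((a1 * z - a2 * y) ^ 2 + (a2 * x - a0 * z) ^ 2 + (a0 * y - a1 * x) ^ 2) * h2 +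
    ((a1 * z - a2 * y) ^ 2 + (a2 * x - a0 * z) ^ 2 + (a0 * y - a1 * x) ^ 2) * (1 - c) ^ 2 * h1

/-- The restriction of a linear isometry of `ℝ³` to the sphere. -/
def sphereMap (R : E3 ≃ₗᵢ[ℝ] E3) (p : S2) : S2 := ⟨R p, by simp⟩

lemma continuous_sphereMap (R : E3 ≃ₗᵢ[ℝ] E3) : Continuous (sphereMap R) :=
  (R.continuous.comp continuous_subtype_val).subtype_mk _

lemma measurePreserving_sphereMap (R : E3 ≃ₗᵢ[ℝ] E3) :
    MeasurePreserving (sphereMap R) area area := by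
  refine ⟨(continuous_sphereMap R).measurable, ?_⟩
  ext s hs
  have hs' := (continuous_sphereMap R).measurable hs
  rw [Measure.map_apply (continuous_sphereMap R).measurable hs, Measure.toSphere_apply' _ hs,
    Measure.toSphere_apply' _ hs']
  congr 1
  conv_rhs => rw [← R.measurePreserving.measure_preimage_equiv (f := R.toMeasurableEquiv)]
  congr 1
  ext x
  simp only [Set.mem_smul, Set.mem_image, Set.mem_preimage]
  constructor
  · rintro ⟨r, hr, _, ⟨p, hp, rfl⟩, rfl⟩
    exact ⟨r, hr, _, ⟨_, hp, rfl⟩, (R.map_smul r (p : E3)).symm⟩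
  · rintro ⟨r, hr, _, ⟨p, hp, rfl⟩, h⟩
    refine ⟨r, hr, _, ⟨sphereMap R.symm p, ?_, rfl⟩, ?_⟩
    · simpa [sphereMap] using hp
    · have hx : x = R.symm (r • (p : E3)) := by
        rw [h]
        exact (R.symm_apply_apply x).symm
      simp [sphereMap, hx]

lemma integral_comp_sphereMap (R : E3 ≃ₗᵢ[ℝ] E3) {f : S2 → ℝ} (hf : Continuous f) :
    ∫ p, f (sphereMap R p) ∂area = ∫ p, f p ∂area := by
  have h := measurePreserving_sphereMap R
  conv_rhs => rw [← h.map_eq]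
  rw [integral_map h.measurable.aemeasurable hf.aestronglyMeasurable]

/-- The derivative of `F` along the rotations about the axis `a`. -/
def rotDeriv {V : Type*} [NormedAddCommGroup V] [NormedSpace ℝ V] (a : E3) (F : E3 → V) :
    E3 → V := fun p => fderiv ℝ F p (cross a p)

lemma hasDerivAt_rotAbout (a : E3) (t : ℝ) (p : E3) :
    HasDerivAt (fun t => rotAbout a t p)
      (Real.cos t • cross a p + Real.sin t • cross a (cross a p)) t := by
  simp only [rotAbout_apply]
  have h1 := ((Real.hasDerivAt_sin t).smul_const (cross a p)).const_add p
  have h2 := ((Real.hasDerivAt_cos t).const_sub 1).smul_const (cross a (cross a p))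
  rw [neg_neg] at h2
  exact h1.add h2

/-- As the area is rotation invariant, derivatives along rotations have integral zero. -/
theorem integral_rotDeriv {a : E3} (ha : ‖a‖ = 1) {F : E3 → ℝ} (hF : ContDiff ℝ ∞ F) :
    ∫ p : S2, rotDeriv a F p ∂area = 0 := by
  have hF1 : Differentiable ℝ F := hF.differentiable (by simp)
  have hF2 : Continuous (fderiv ℝ F) := hF.continuous_fderiv (by simp)
  have hrot : Continuous fun x : ℝ × S2 => rotAbout a x.1 (x.2 : E3) := by
    simp only [rotAbout_apply, ← crossCLM_apply]
    fun_prop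
  let F' : ℝ → S2 → ℝ := fun t p => fderiv ℝ F (rotAbout a t p)
    (Real.cos t • cross a p + Real.sin t • cross a (cross a p))
  have hF' : Continuous (Function.uncurry F') := by
    refine (hF2.comp hrot).clm_apply ?_
    simp only [← crossCLM_apply]
    fun_prop
  obtain ⟨C, hC⟩ := (isCompact_Icc (a := (-1 : ℝ)) (b := 1)).prod (isCompact_univ (X := S2))
    |>.exists_bound_of_continuousOn hF'.continuousOn
  have hcont : ∀ t, Continuous fun p : S2 => F (rotAbout a t p) := fun t =>
    hF.continuous.comp ((rotAbout a t).continuous.comp continuous_subtype_val)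
  have key := (hasDerivAt_integral_of_dominated_loc_of_deriv_le (μ := area) (x₀ := (0 : ℝ))
    (F := fun t (p : S2) => F (rotAbout a t p)) (F' := F') (bound := fun _ => C)
    (Icc_mem_nhds (by norm_num : (-1 : ℝ) < 0) (by norm_num : (0 : ℝ) < 1))
    (Eventually.of_forall fun t => (hcont t).aestronglyMeasurable)
    ((hcont 0).integrable_of_hasCompactSupport (HasCompactSupport.of_compactSpace _))
    ((hF'.comp (Continuous.prodMk_right (0 : ℝ))).aestronglyMeasurable)
    (Eventually.of_forall fun p t ht => hC (t, p) ⟨ht, Set.mem_univ _⟩)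
    (integrable_const C)
    (Eventually.of_forall fun p t _ =>
      (hF1 _).hasFDerivAt.comp_hasDerivAt t (hasDerivAt_rotAbout a t p))).2
  have hconst : (fun t => ∫ p : S2, F (rotAbout a t p) ∂area) = fun _ => ∫ p : S2, F p ∂area := by
    funext t
    let R : E3 ≃ₗᵢ[ℝ] E3 := LinearIsometry.toLinearIsometryEquiv
      ⟨(rotAbout a t).toLinearMap, norm_rotAbout ha t⟩ rfl
    exact integral_comp_sphereMap R (f := fun p : S2 => F p)
      (hF.continuous.comp continuous_subtype_val)
  rw [hconst] at key
  have h0 := key.unique (hasDerivAt_const _ _)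
  simpa [F', rotAbout_apply, rotDeriv] using h0

/-! ### Calculus with rotational derivatives -/

lemma integrable_of_continuous {V : Type*} [NormedAddCommGroup V] {f : S2 → V}
    (hf : Continuous f) : Integrable f area :=
  hf.integrable_of_hasCompactSupport (HasCompactSupport.of_compactSpace _)

section Calculus

variable {V : Type*} [NormedAddCommGroup V] [NormedSpace ℝ V]

/-- The Laplacian of the sphere, `Δ = ∑ᵢ Dᵢ²`, where `Dᵢ` is the derivative along the rotations
about the `i`-th axis. It acts on functions on `ℝ³`. -/
def lap (F : E3 → V) : E3 → V :=
  fun p => ∑ i, rotDeriv (basisVec i) (rotDeriv (basisVec i) F) p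

lemma contDiff_rotDeriv (a : E3) {F : E3 → V} (hF : ContDiff ℝ ∞ F) :
    ContDiff ℝ ∞ (rotDeriv a F) :=
  (hF.fderiv_right (m := ∞) (by simp)).clm_apply (crossCLM a).contDiff

lemma contDiff_lap {F : E3 → V} (hF : ContDiff ℝ ∞ F) : ContDiff ℝ ∞ (lap F) :=
  ContDiff.sum fun _ _ => contDiff_rotDeriv _ (contDiff_rotDeriv _ hF)

lemma rotDeriv_clm_comp {W : Type*} [NormedAddCommGroup W] [NormedSpace ℝ W] (T : V →L[ℝ] W)
    (a : E3) {F : E3 → V} (hF : ContDiff ℝ ∞ F) :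
    rotDeriv a (fun p => T (F p)) = fun p => T (rotDeriv a F p) := by
  funext p
  have h := T.hasFDerivAt.comp p ((hF.differentiable (by simp)) p).hasFDerivAt
  exact congrArg (fun l => l (cross a p)) h.fderiv

lemma lap_clm_comp {W : Type*} [NormedAddCommGroup W] [NormedSpace ℝ W] (T : V →L[ℝ] W)
    {F : E3 → V} (hF : ContDiff ℝ ∞ F) : lap (fun p => T (F p)) = fun p => T (lap F p) := by
  funext p
  simp only [lap, map_sum]
  refine Finset.sum_congr rfl fun i _ => ?_
  rw [rotDeriv_clm_comp T _ hF, rotDeriv_clm_comp T _ (contDiff_rotDeriv _ hF)]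

lemma rotDeriv_mul {A : Type*} [NormedCommRing A] [NormedAlgebra ℝ A] (a : E3) {F G : E3 → A}
    (hF : ContDiff ℝ ∞ F) (hG : ContDiff ℝ ∞ G) (p : E3) :
    rotDeriv a (fun p => F p * G p) p = F p * rotDeriv a G p + G p * rotDeriv a F p := by
  have h := ((hF.differentiable (by simp)) p).hasFDerivAt.mul
    ((hG.differentiable (by simp)) p).hasFDerivAt
  exact congrArg (fun l => l (cross a p)) h.fderiv

lemma norm_basisVec (i : Fin 3) : ‖basisVec i‖ = 1 := by simp [basisVec]

/-- Integration by parts. -/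
lemma integral_mul_rotDeriv (i : Fin 3) {F G : E3 → ℝ} (hF : ContDiff ℝ ∞ F)
    (hG : ContDiff ℝ ∞ G) :
    ∫ p : S2, F p * rotDeriv (basisVec i) G p ∂area =
      -∫ p : S2, G p * rotDeriv (basisVec i) F p ∂area := by
  have h := integral_rotDeriv (norm_basisVec i) (hF.mul hG)
  have h1 : Continuous fun p : S2 => F p * rotDeriv (basisVec i) G p :=
    (hF.mul (contDiff_rotDeriv _ hG)).continuous.comp continuous_subtype_val
  have h2 : Continuous fun p : S2 => G p * rotDeriv (basisVec i) F p :=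
    (hG.mul (contDiff_rotDeriv _ hF)).continuous.comp continuous_subtype_val
  simp only [rotDeriv_mul _ hF hG] at h
  rw [integral_add (integrable_of_continuous h1) (integrable_of_continuous h2)] at h
  linarith

end Calculus

lemma fderiv_eq_inner_gradient (f : TestFun) (p v : E3) :
    fderiv ℝ f.1 p v = ⟪gradient f.1 p, v⟫_ℝ := by
  simp [gradient]

lemma gradient_apply (f : TestFun) (p : E3) (k : Fin 3) :
    gradient f.1 p k = fderiv ℝ f.1 p (basisVec k) := by
  rw [fderiv_eq_inner_gradient, inner_eq_sum]
  generalize gradient f.1 p = a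
  fin_cases k <;> simp [basisVec_apply]

lemma rotDeriv_eq (a : E3) (f : TestFun) (p : E3) :
    rotDeriv a f.1 p = ⟪gradient f.1 p, cross a p⟫_ℝ :=
  fderiv_eq_inner_gradient f p _

lemma inner_surfGrad_self_point (f : TestFun) (p : S2) : ⟪surfGrad f p, (p : E3)⟫_ℝ = 0 := by
  simp [surfGrad, inner_sub_left, inner_smul_left]

lemma inner_perp_perp (u v : S2 → E3) (p : S2) (hv : ⟪v p, (p : E3)⟫_ℝ = 0) :
    ⟪perp u p, perp v p⟫_ℝ = ⟪u p, v p⟫_ℝ := by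
  have hp := sq_add_sq_add_sq p
  simp only [inner_eq_sum, perp, cross_apply_zero, cross_apply_one, cross_apply_two] at *
  linear_combination (u p 0 * v p 0 + u p 1 * v p 1 + u p 2 * v p 2) * hp -
    (u p 0 * (p : E3) 0 + u p 1 * (p : E3) 1 + u p 2 * (p : E3) 2) * hv

lemma inner_surfGrad_surfGrad (f g : TestFun) (p : S2) :
    ⟪surfGrad f p, surfGrad g p⟫_ℝ =
      ∑ i, rotDeriv (basisVec i) f.1 p * rotDeriv (basisVec i) g.1 p := by
  have hp := sq_add_sq_add_sq p
  simp only [rotDeriv_eq, Fin.sum_univ_three, inner_eq_sum, surfGrad, cross_apply_zero,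
    cross_apply_one, cross_apply_two, basisVec_apply, PiLp.sub_apply, PiLp.smul_apply,
    smul_eq_mul]
  generalize gradient f.1 (p : E3) = a
  generalize gradient g.1 (p : E3) = b
  simp
  generalize (p : E3) 0 = x at *
  generalize (p : E3) 1 = y at *
  generalize (p : E3) 2 = z at *
  linear_combination ((a 0 * x + a 1 * y + a 2 * z) * (b 0 * x + b 1 * y + b 2 * z) -
    (a 0 * b 0 + a 1 * b 1 + a 2 * b 2)) * hp

lemma inner_surfRotGrad_surfGrad (f g : TestFun) (p : S2) :
    ⟪surfRotGrad f p, surfGrad g p⟫_ℝ =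
      ∑ k, fderiv ℝ g.1 p (basisVec k) * rotDeriv (basisVec k) f.1 p := by
  simp only [rotDeriv_eq, ← gradient_apply, Fin.sum_univ_three, inner_eq_sum, surfRotGrad, perp,
    surfGrad, cross_apply_zero, cross_apply_one, cross_apply_two, basisVec_apply, PiLp.sub_apply,
    PiLp.smul_apply, smul_eq_mul]
  simp
  ring

lemma inner_surfRotGrad_surfRotGrad (f g : TestFun) (p : S2) :
    ⟪surfRotGrad f p, surfRotGrad g p⟫_ℝ = ⟪surfGrad f p, surfGrad g p⟫_ℝ :=
  inner_perp_perp _ _ p (inner_surfGrad_self_point g p)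

lemma surfRotGrad_apply (f : TestFun) (p : S2) (k : Fin 3) :
    surfRotGrad f p k = rotDeriv (basisVec k) f.1 p := by
  rw [rotDeriv_eq]
  simp only [inner_eq_sum, surfRotGrad, perp, surfGrad, cross_apply_zero, cross_apply_one,
    cross_apply_two, basisVec_apply]
  fin_cases k <;>
  simp [cross_apply_zero, cross_apply_one, cross_apply_two] <;> ring

/-- Green's formula on the sphere. -/
theorem integral_inner_surfGrad (f g : TestFun) :
    ∫ p, ⟪surfGrad f p, surfGrad g p⟫_ℝ ∂area = -∫ p : S2, f.1 p * lap g.1 p ∂area := by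
  have hc : ∀ i, Continuous fun p : S2 =>
      rotDeriv (basisVec i) f.1 p * rotDeriv (basisVec i) g.1 p := fun i =>
    ((contDiff_rotDeriv _ f.2).mul (contDiff_rotDeriv _ g.2)).continuous.comp
      continuous_subtype_val
  have hc' : ∀ i, Continuous fun p : S2 =>
      f.1 p * rotDeriv (basisVec i) (rotDeriv (basisVec i) g.1) p := fun i =>
    (f.2.mul (contDiff_rotDeriv _ (contDiff_rotDeriv _ g.2))).continuous.comp
      continuous_subtype_val
  simp only [inner_surfGrad_surfGrad, lap, Finset.mul_sum]
  rw [integral_finsetSum _ fun i _ => integrable_of_continuous (hc i),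
    integral_finsetSum _ fun i _ => integrable_of_continuous (hc' i), ← Finset.sum_neg_distrib]
  refine Finset.sum_congr rfl fun i _ => ?_
  rw [integral_mul_rotDeriv i f.2 (contDiff_rotDeriv _ g.2), neg_neg]
  simp only [mul_comm]

/-- Gradients and rotated gradients are orthogonal. Integrating by parts leaves
`∑ₖ Dₖ ∂ₖ g (p) = ∑ₖ D²g(p)(eₖ × p, eₖ)`, which vanishes as `D²g(p)` is symmetric. -/
theorem integral_inner_surfRotGrad_surfGrad (f g : TestFun) :
    ∫ p, ⟪surfRotGrad f p, surfGrad g p⟫_ℝ ∂area = 0 := by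
  have hg : ∀ k, ContDiff ℝ ∞ fun p => fderiv ℝ g.1 p (basisVec k) := fun k =>
    (g.2.fderiv_right (m := ∞) (by simp)).clm_apply contDiff_const
  have hc : ∀ k, Continuous fun p : S2 =>
      fderiv ℝ g.1 p (basisVec k) * rotDeriv (basisVec k) f.1 p := fun k =>
    ((hg k).mul (contDiff_rotDeriv _ f.2)).continuous.comp continuous_subtype_val
  have hc' : ∀ k, Continuous fun p : S2 =>
      f.1 p * rotDeriv (basisVec k) (fun p => fderiv ℝ g.1 p (basisVec k)) p := fun k =>
    (f.2.mul (contDiff_rotDeriv _ (hg k))).continuous.comp continuous_subtype_val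
  simp only [inner_surfRotGrad_surfGrad]
  rw [integral_finsetSum _ fun k _ => integrable_of_continuous (hc k)]
  simp only [integral_mul_rotDeriv _ (hg _) f.2]
  rw [Finset.sum_neg_distrib, ← integral_finsetSum _ fun k _ => integrable_of_continuous (hc' k)]
  have h0 : ∀ p : S2, ∑ k, f.1 p *
      rotDeriv (basisVec k) (fun p => fderiv ℝ g.1 p (basisVec k)) p = 0 := by
    intro p
    have hd : Differentiable ℝ (fderiv ℝ g.1) :=
      (g.2.fderiv_right (m := ∞) (by simp)).differentiable (by simp)
    have hD : ∀ k, rotDeriv (basisVec k) (fun p => fderiv ℝ g.1 p (basisVec k)) p =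
        fderiv ℝ (fderiv ℝ g.1) p (cross (basisVec k) p) (basisVec k) := by
      intro k
      have h := (hd (p : E3)).hasFDerivAt.clm_apply (hasFDerivAt_const (basisVec k) (p : E3))
      have := congrArg (fun l => l (cross (basisVec k) p)) h.fderiv
      simpa [rotDeriv] using this
    have hsymm : ∀ v w, fderiv ℝ (fderiv ℝ g.1) (p : E3) v w =
        fderiv ℝ (fderiv ℝ g.1) (p : E3) w v := by
      have := (g.2.contDiffAt (x := (p : E3))).isSymmSndFDerivAt
        (by simpa using ENat.LEInfty.out)
      exact fun v w => this v w
    have e0 : cross (basisVec 0) p = (p : E3) 1 • basisVec 2 - (p : E3) 2 • basisVec 1 := by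
      apply ext_E3 <;> simp [cross_apply_zero, cross_apply_one, cross_apply_two, basisVec_apply]
    have e1 : cross (basisVec 1) p = (p : E3) 2 • basisVec 0 - (p : E3) 0 • basisVec 2 := by
      apply ext_E3 <;> simp [cross_apply_zero, cross_apply_one, cross_apply_two, basisVec_apply]
    have e2 : cross (basisVec 2) p = (p : E3) 0 • basisVec 1 - (p : E3) 1 • basisVec 0 := by
      apply ext_E3 <;> simp [cross_apply_zero, cross_apply_one, cross_apply_two, basisVec_apply]
    rw [← Finset.mul_sum, Fin.sum_univ_three, hD, hD, hD, e0, e1, e2]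
    simp only [map_sub, map_smul, sub_apply, smul_apply]
    rw [hsymm (basisVec 2) (basisVec 0), hsymm (basisVec 2) (basisVec 1),
      hsymm (basisVec 1) (basisVec 0)]
    simp only [smul_eq_mul]
    ring
  simp [h0]

/-! ### Smooth functions inside the square-integrable ones -/

/-- The smooth functions form a linear subspace of all functions on `ℝ³`. -/
def smoothSubmodule : Submodule ℝ (E3 → ℝ) where
  carrier := {f | ContDiff ℝ ∞ f}
  add_mem' {f g} (hf : ContDiff ℝ ∞ f) (hg : ContDiff ℝ ∞ g) := hf.add hg
  zero_mem' := (contDiff_const : ContDiff ℝ ∞ fun _ : E3 => (0 : ℝ))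
  smul_mem' c f (hf : ContDiff ℝ ∞ f) :=
    (hf.const_smul c : ContDiff ℝ ∞ (c • f))

/-- Smooth functions are added pointwise on `ℝ³`. -/
instance : AddCommGroup TestFun := inferInstanceAs (AddCommGroup smoothSubmodule)

instance : Module ℝ TestFun := inferInstanceAs (Module ℝ smoothSubmodule)

namespace TestFun

lemma contDiff (f : TestFun) : ContDiff ℝ ∞ f.1 := f.2

lemma differentiable (f : TestFun) : Differentiable ℝ f.1 := f.contDiff.differentiable (by simp)

/-- The constant function `1`. -/
def one : TestFun := ⟨fun _ => 1, contDiff_const⟩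

/-- The product of smooth functions. -/
def mul (f g : TestFun) : TestFun := ⟨fun p => f.1 p * g.1 p, f.contDiff.mul g.contDiff⟩

/-- The derivative of a smooth function along the rotations about the `i`-th axis. -/
def rot (i : Fin 3) (f : TestFun) : TestFun :=
  ⟨rotDeriv (basisVec i) f.1, contDiff_rotDeriv _ f.contDiff⟩

/-- The Laplacian of the sphere on smooth functions. -/
def laplacian (f : TestFun) : TestFun := ⟨lap f.1, contDiff_lap f.contDiff⟩

end TestFun

lemma gradient_add (f g : TestFun) (p : E3) :
    gradient (f + g).1 p = gradient f.1 p + gradient g.1 p := by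
  simp only [gradient, ← map_add]
  exact congrArg _ (fderiv_add (f.differentiable p) (g.differentiable p))

lemma gradient_smul (c : ℝ) (f : TestFun) (p : E3) :
    gradient (c • f).1 p = c • gradient f.1 p := by
  simp only [gradient]
  rw [← LinearIsometryEquiv.map_smul]
  exact congrArg _ (fderiv_const_smul (f.differentiable p) c)

lemma surfGrad_add (f g : TestFun) (p : S2) :
    surfGrad (f + g) p = surfGrad f p + surfGrad g p := by
  simp only [surfGrad, gradient_add, inner_add_left, add_smul]
  abel

lemma surfGrad_smul (c : ℝ) (f : TestFun) (p : S2) :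
    surfGrad (c • f) p = c • surfGrad f p := by
  simp only [surfGrad, gradient_smul, inner_smul_left, smul_sub, smul_smul]
  simp

lemma continuous_surfGrad (f : TestFun) : Continuous (surfGrad f) := by
  have h : Continuous fun p : S2 => gradient f.1 (p : E3) :=
    ((InnerProductSpace.toDual ℝ E3).symm.continuous.comp
      (f.2.continuous_fderiv (by simp))).comp continuous_subtype_val
  have h' : Continuous fun p : S2 => ⟪gradient f.1 (p : E3), (p : E3)⟫_ℝ :=
    h.inner continuous_subtype_val
  exact h.sub (h'.smul continuous_subtype_val)

lemma continuous_surfRotGrad (f : TestFun) : Continuous (surfRotGrad f) := by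
  refine (PiLp.continuous_toLp 2 fun _ : Fin 3 => ℝ).comp (continuous_pi fun k => ?_)
  have h : Continuous fun p : S2 => rotDeriv (basisVec k) f.1 p :=
    (contDiff_rotDeriv _ f.2).continuous.comp continuous_subtype_val
  exact h.congr fun p => (surfRotGrad_apply f p k).symm

/-- The class in `L²` of a smooth function. -/
def toL2 : TestFun →ₗ[ℝ] ScalarL2 :=
  (ContinuousMap.toLp 2 area ℝ).toLinearMap ∘ₗ
    { toFun := fun f => (⟨fun p => f.1 p, f.contDiff.continuous.comp continuous_subtype_val⟩ :
        C(S2, ℝ))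
      map_add' := fun _ _ => rfl
      map_smul' := fun _ _ => rfl }

/-- The class in `L²` of the gradient of a smooth function. -/
def gradL2 : TestFun →ₗ[ℝ] FieldL2 :=
  (ContinuousMap.toLp 2 area ℝ).toLinearMap ∘ₗ
    { toFun := fun f => (⟨surfGrad f, continuous_surfGrad _⟩ : C(S2, E3))
      map_add' := fun f g => ContinuousMap.ext (surfGrad_add f g)
      map_smul' := fun c f => ContinuousMap.ext (surfGrad_smul c f) }

/-- The class in `L²` of the rotated gradient of a smooth function. -/
def rotL2 : TestFun →ₗ[ℝ] FieldL2 :=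
  (ContinuousMap.toLp 2 area ℝ).toLinearMap ∘ₗ
    { toFun := fun f => (⟨surfRotGrad f, continuous_surfRotGrad _⟩ : C(S2, E3))
      map_add' := fun f g => ContinuousMap.ext fun p => by
        simp [surfRotGrad, perp, surfGrad_add, cross]
      map_smul' := fun c f => ContinuousMap.ext fun p => by
        simp [surfRotGrad, perp, surfGrad_smul, cross] }

lemma coeFn_toL2 (f : TestFun) : toL2 f =ᵐ[area] fun p : S2 => f.1 p :=
  ContinuousMap.coeFn_toLp area _

lemma coeFn_gradL2 (f : TestFun) : gradL2 f =ᵐ[area] surfGrad f :=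
  ContinuousMap.coeFn_toLp area _

lemma coeFn_rotL2 (f : TestFun) : rotL2 f =ᵐ[area] surfRotGrad f :=
  ContinuousMap.coeFn_toLp area _

lemma inner_toL2 (f : TestFun) (χ : ScalarL2) : ⟪toL2 f, χ⟫_ℝ = ∫ p : S2, f.1 p * χ p ∂area := by
  rw [L2.inner_def]
  refine integral_congr_ae ?_
  filter_upwards [coeFn_toL2 f] with p hp
  rw [hp, real_inner_eq_re_inner, RCLike.inner_apply]
  simp [mul_comm]

lemma inner_toL2_toL2 (f g : TestFun) :
    ⟪toL2 f, toL2 g⟫_ℝ = ∫ p : S2, f.1 p * g.1 p ∂area := by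
  rw [inner_toL2]
  refine integral_congr_ae ?_
  filter_upwards [coeFn_toL2 g] with p hp
  rw [hp]

lemma inner_gradL2 (f : TestFun) (u : FieldL2) :
    ⟪gradL2 f, u⟫_ℝ = ∫ p : S2, ⟪u p, surfGrad f p⟫_ℝ ∂area := by
  rw [L2.inner_def]
  refine integral_congr_ae ?_
  filter_upwards [coeFn_gradL2 f] with p hp
  rw [hp, real_inner_comm]

lemma inner_rotL2 (f : TestFun) (u : FieldL2) :
    ⟪rotL2 f, u⟫_ℝ = ∫ p : S2, ⟪u p, surfRotGrad f p⟫_ℝ ∂area := by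
  rw [L2.inner_def]
  refine integral_congr_ae ?_
  filter_upwards [coeFn_rotL2 f] with p hp
  rw [hp, real_inner_comm]

lemma integral_eq_inner_one (χ : ScalarL2) : ∫ p, χ p ∂area = ⟪toL2 TestFun.one, χ⟫_ℝ := by
  simp [inner_toL2, TestFun.one]

lemma divDist_eq_neg_inner (u : FieldL2) (f : TestFun) : divDist u f = -⟪gradL2 f, u⟫_ℝ := by
  rw [inner_gradL2, divDist]

lemma isDivFree_iff (u : FieldL2) : IsDivFree u ↔ ∀ f, ⟪gradL2 f, u⟫_ℝ = 0 := by
  simp only [IsDivFree, divDist_eq_neg_inner, neg_eq_zero]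

lemma inner_gradL2_gradL2 (f g : TestFun) :
    ⟪gradL2 f, gradL2 g⟫_ℝ = -⟪toL2 g.laplacian, toL2 f⟫_ℝ := by
  rw [inner_toL2_toL2, inner_gradL2]
  have h := integral_inner_surfGrad f g
  have h1 : ∫ p : S2, f.1 p * lap g.1 p ∂area =
      ∫ p : S2, g.laplacian.1 p * f.1 p ∂area :=
    integral_congr_ae (Eventually.of_forall fun p => mul_comm _ _)
  rw [← h1, ← h]
  refine integral_congr_ae ?_
  filter_upwards [coeFn_gradL2 g] with p hp
  rw [hp, real_inner_comm]

lemma inner_rotL2_rotL2 (f g : TestFun) : ⟪rotL2 f, rotL2 g⟫_ℝ = ⟪gradL2 f, gradL2 g⟫_ℝ := by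
  rw [inner_gradL2, inner_rotL2]
  refine integral_congr_ae ?_
  filter_upwards [coeFn_gradL2 g, coeFn_rotL2 g] with p hp hp'
  rw [hp, hp', inner_surfRotGrad_surfRotGrad]

lemma inner_rotL2_gradL2 (f g : TestFun) : ⟪rotL2 f, gradL2 g⟫_ℝ = 0 := by
  rw [real_inner_comm, inner_gradL2, ← integral_inner_surfRotGrad_surfGrad f g]
  refine integral_congr_ae ?_
  filter_upwards [coeFn_rotL2 f] with p hp
  rw [hp]

lemma norm_rotL2 (f : TestFun) : ‖rotL2 f‖ = ‖gradL2 f‖ := by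
  rw [← sq_eq_sq₀ (norm_nonneg _) (norm_nonneg _), ← real_inner_self_eq_norm_sq,
    ← real_inner_self_eq_norm_sq, inner_rotL2_rotL2]

/-! ### Weak derivatives -/

lemma tendsto_eLpNorm_sub_iff {V : Type*} [NormedAddCommGroup V] {F : ℕ → S2 → V}
    {U : ℕ → Lp V 2 area} (hU : ∀ n, U n =ᵐ[area] F n) (u : Lp V 2 area) :
    Tendsto (fun n => eLpNorm (fun p => F n p - u p) 2 area) atTop (𝓝 0) ↔
      Tendsto U atTop (𝓝 u) := by
  rw [tendsto_iff_edist_tendsto_0]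
  refine iff_of_eq (congrArg (fun s => Tendsto s atTop (𝓝 0)) (funext fun n => ?_))
  rw [Lp.edist_def]
  refine eLpNorm_congr_ae ?_
  filter_upwards [hU n] with p hp
  simp [hp]

lemma hasGrad_iff (χ : ScalarL2) (g : FieldL2) :
    HasGrad χ g ↔ ∃ F : ℕ → TestFun, Tendsto (fun n => toL2 (F n)) atTop (𝓝 χ) ∧
      Tendsto (fun n => gradL2 (F n)) atTop (𝓝 g) := by
  constructor
  · rintro ⟨F, h1, h2⟩
    exact ⟨F,
      (tendsto_eLpNorm_sub_iff (fun n => coeFn_toL2 (F n)) χ).1 h1,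
      (tendsto_eLpNorm_sub_iff (fun n => coeFn_gradL2 (F n)) g).1 h2⟩
  · rintro ⟨F, h1, h2⟩
    exact ⟨F,
      (tendsto_eLpNorm_sub_iff (fun n => coeFn_toL2 (F n)) χ).2 h1,
      (tendsto_eLpNorm_sub_iff (fun n => coeFn_gradL2 (F n)) g).2 h2⟩

lemma hasRotGrad_iff (χ : ScalarL2) (g : FieldL2) :
    HasRotGrad χ g ↔ ∃ F : ℕ → TestFun, Tendsto (fun n => toL2 (F n)) atTop (𝓝 χ) ∧
      Tendsto (fun n => rotL2 (F n)) atTop (𝓝 g) := by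
  constructor
  · rintro ⟨F, h1, h2⟩
    exact ⟨F,
      (tendsto_eLpNorm_sub_iff (fun n => coeFn_toL2 (F n)) χ).1 h1,
      (tendsto_eLpNorm_sub_iff (fun n => coeFn_rotL2 (F n)) g).1 h2⟩
  · rintro ⟨F, h1, h2⟩
    exact ⟨F,
      (tendsto_eLpNorm_sub_iff (fun n => coeFn_toL2 (F n)) χ).2 h1,
      (tendsto_eLpNorm_sub_iff (fun n => coeFn_rotL2 (F n)) g).2 h2⟩

/-- The closed space of gradients. -/
def gradSpace : Submodule ℝ FieldL2 := (LinearMap.range gradL2).topologicalClosure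

/-- The closed space of rotated gradients. -/
def rotSpace : Submodule ℝ FieldL2 := (LinearMap.range rotL2).topologicalClosure

lemma HasGrad.mem_gradSpace {χ : ScalarL2} {g : FieldL2} (h : HasGrad χ g) : g ∈ gradSpace := by
  obtain ⟨F, -, h2⟩ := (hasGrad_iff χ g).1 h
  exact mem_closure_of_tendsto h2 (Eventually.of_forall fun n => ⟨F n, rfl⟩)

lemma HasRotGrad.mem_rotSpace {χ : ScalarL2} {g : FieldL2} (h : HasRotGrad χ g) :
    g ∈ rotSpace := by
  obtain ⟨F, -, h2⟩ := (hasRotGrad_iff χ g).1 h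
  exact mem_closure_of_tendsto h2 (Eventually.of_forall fun n => ⟨F n, rfl⟩)

lemma HasGrad.inner_gradL2 {χ : ScalarL2} {g : FieldL2} (h : HasGrad χ g) (f : TestFun) :
    ⟪gradL2 f, g⟫_ℝ = -⟪toL2 f.laplacian, χ⟫_ℝ := by
  obtain ⟨F, h1, h2⟩ := (hasGrad_iff χ g).1 h
  refine tendsto_nhds_unique (tendsto_const_nhds.inner h2) ?_
  exact ((tendsto_const_nhds (x := toL2 f.laplacian)).inner h1).neg.congr fun n =>
    (inner_gradL2_gradL2 (F n) f).symm.trans (real_inner_comm _ _)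

lemma HasGrad.inner_rotL2 {χ : ScalarL2} {g : FieldL2} (h : HasGrad χ g) (f : TestFun) :
    ⟪rotL2 f, g⟫_ℝ = 0 := by
  obtain ⟨F, -, h2⟩ := (hasGrad_iff χ g).1 h
  refine tendsto_nhds_unique (tendsto_const_nhds.inner h2) ?_
  simp [inner_rotL2_gradL2]

lemma HasRotGrad.inner_rotL2 {χ : ScalarL2} {g : FieldL2} (h : HasRotGrad χ g) (f : TestFun) :
    ⟪rotL2 f, g⟫_ℝ = -⟪toL2 f.laplacian, χ⟫_ℝ := by
  obtain ⟨F, h1, h2⟩ := (hasRotGrad_iff χ g).1 h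
  refine tendsto_nhds_unique (tendsto_const_nhds.inner h2) ?_
  exact ((tendsto_const_nhds (x := toL2 f.laplacian)).inner h1).neg.congr fun n =>
    ((inner_rotL2_rotL2 f (F n)).trans ((real_inner_comm _ _).trans
      (inner_gradL2_gradL2 (F n) f))).symm

lemma inner_gradL2_of_mem_rotSpace {g : FieldL2} (h : g ∈ rotSpace) (f : TestFun) :
    ⟪gradL2 f, g⟫_ℝ = 0 := by
  have hc : IsClosed {g : FieldL2 | ⟪gradL2 f, g⟫_ℝ = 0} :=
    isClosed_eq (continuous_const.inner continuous_id) continuous_const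
  refine closure_minimal ?_ hc h
  rintro _ ⟨F, rfl⟩
  exact (real_inner_comm _ _).trans (inner_rotL2_gradL2 F f)

lemma eq_zero_of_mem_rotSpace {g : FieldL2} (h : g ∈ rotSpace)
    (h0 : ∀ f, ⟪rotL2 f, g⟫_ℝ = 0) : g = 0 := by
  have hc : IsClosed {v : FieldL2 | ⟪v, g⟫_ℝ = 0} :=
    isClosed_eq (continuous_id.inner continuous_const) continuous_const
  have : ⟪g, g⟫_ℝ = 0 := by
    refine closure_minimal ?_ hc h
    rintro _ ⟨F, rfl⟩
    exact h0 F
  exact inner_self_eq_zero.1 this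

lemma eq_zero_of_mem_gradSpace {g : FieldL2} (h : g ∈ gradSpace)
    (h0 : ∀ f, ⟪gradL2 f, g⟫_ℝ = 0) : g = 0 := by
  have hc : IsClosed {v : FieldL2 | ⟪v, g⟫_ℝ = 0} :=
    isClosed_eq (continuous_id.inner continuous_const) continuous_const
  have : ⟪g, g⟫_ℝ = 0 := by
    refine closure_minimal ?_ hc h
    rintro _ ⟨F, rfl⟩
    exact h0 F
  exact inner_self_eq_zero.1 this

lemma HasRotGrad.eq_zero {g : FieldL2} (h : HasRotGrad 0 g) : g = 0 :=
  eq_zero_of_mem_rotSpace h.mem_rotSpace fun f => by rw [h.inner_rotL2, inner_zero_right, neg_zero]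

lemma isTangent_of_mem_rotSpace {w : FieldL2} (hw : w ∈ rotSpace) : IsTangent w := by
  -- the radial part `r` of `w` is orthogonal to the tangent fields `∇^⊥ f`, hence to `w`
  have hmeas : AEStronglyMeasurable (fun p : S2 => ⟪w p, (p : E3)⟫_ℝ • (p : E3)) area := by
    have h : AEStronglyMeasurable (fun p : S2 => ⟪w p, (p : E3)⟫_ℝ) area :=
      (Lp.aestronglyMeasurable w).inner continuous_subtype_val.aestronglyMeasurable
    exact h.smul continuous_subtype_val.aestronglyMeasurable
  have hr : MemLp (fun p : S2 => ⟪w p, (p : E3)⟫_ℝ • (p : E3)) 2 area := by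
    refine (Lp.memLp w).mono hmeas (Eventually.of_forall fun p => ?_)
    have hp : ‖(p : E3)‖ = 1 := by simp
    rw [norm_smul, hp, mul_one]
    simpa [hp] using norm_inner_le_norm (𝕜 := ℝ) (w p) (p : E3)
  set r : FieldL2 := hr.toLp with hrdef
  have h0 : ∀ f, ⟪rotL2 f, r⟫_ℝ = 0 := by
    intro f
    rw [inner_rotL2]
    refine integral_eq_zero_of_ae ?_
    filter_upwards [hr.coeFn_toLp] with p hp
    have : ⟪(p : E3), surfRotGrad f p⟫_ℝ = 0 := by
      simp only [inner_eq_sum, surfRotGrad, perp, cross_apply_zero, cross_apply_one,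
        cross_apply_two]
      ring
    rw [hp, inner_smul_left, this]
    simp
  have hc : IsClosed {v : FieldL2 | ⟪v, r⟫_ℝ = 0} :=
    isClosed_eq (continuous_id.inner continuous_const) continuous_const
  have hwr : ⟪w, r⟫_ℝ = 0 := by
    refine closure_minimal ?_ hc hw
    rintro _ ⟨F, rfl⟩
    exact h0 F
  have hrr : ⟪r, r⟫_ℝ = 0 := by
    rw [← hwr, L2.inner_def, L2.inner_def]
    refine integral_congr_ae ?_
    filter_upwards [hr.coeFn_toLp] with p hp
    have h1 : ⟪(p : E3), (p : E3)⟫_ℝ = 1 := by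
      rw [real_inner_self_eq_norm_sq]
      simp
    rw [hp, inner_smul_left, inner_smul_right, inner_smul_right, h1]
    simp
  have hr0 : r = 0 := inner_self_eq_zero.1 hrr
  filter_upwards [hr.coeFn_toLp, (Lp.eq_zero_iff_ae_eq_zero).1 hr0] with p hp hp0
  have h1 : ‖(p : E3)‖ = 1 := by simp
  rw [hp0] at hp
  have h2 := congrArg norm hp.symm
  rw [norm_smul, h1] at h2
  simpa using h2

/-! ### The functions `(x + iy)ᵐ q(z)` -/

open Polynomial in
/-- The polynomial `(d/dz)^{l+m} (1-z²)^l`, which is `(-2)^l l!` times the `m`-th derivative of the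
Legendre polynomial of degree `l`. -/
def legendreDeriv (l m : ℕ) : ℝ[X] := derivative^[l + m] ((1 - X ^ 2) ^ l)

section Legendre

open Polynomial

/-- The differential equation obtained by differentiating `(1-X²) f' + 2 l X f = 0`,
`f = (1-X²)^l`, repeatedly. -/
lemma iterate_derivative_one_sub_sq_pow (l n : ℕ) :
    (1 - X ^ 2) * derivative^[n + 2] ((1 - X ^ 2 : ℝ[X]) ^ l) =
      C (2 * ((n : ℝ) + 1 - l)) * X * derivative^[n + 1] ((1 - X ^ 2 : ℝ[X]) ^ l) +
        C (((n : ℝ) + 1) * (n - 2 * l)) * derivative^[n] ((1 - X ^ 2 : ℝ[X]) ^ l) := by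
  have h0 : (1 - X ^ 2) * derivative ((1 - X ^ 2 : ℝ[X]) ^ l) =
      -(C (2 * (l : ℝ)) * X * (1 - X ^ 2) ^ l) := by
    rcases l with _ | l
    · simp
    · rw [derivative_pow]
      simp only [map_sub, derivative_one, derivative_X_pow, map_mul, map_add, map_one, map_natCast,
        Nat.cast_add, Nat.cast_one, add_tsub_cancel_right, map_ofNat, Nat.cast_ofNat]
      ring
  induction n with
  | zero =>
    have h1 := congrArg derivative h0
    simp only [derivative_mul, map_sub, derivative_one, derivative_X_pow, derivative_neg,
      derivative_C, derivative_X] at h1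
    simp only [Function.iterate_succ_apply', Function.iterate_zero_apply]
    simp only [map_mul, map_sub, map_one, map_natCast, map_ofNat, Nat.cast_zero,
      Nat.cast_ofNat, map_zero, zero_add] at h1 ⊢
    linear_combination h1
  | succ n ih =>
    have h1 := congrArg derivative ih
    simp only [derivative_mul, map_sub, derivative_one, derivative_X_pow, derivative_add,
      derivative_C, derivative_X, ← Function.iterate_succ_apply'] at h1
    simp only [map_mul, map_add, map_sub, map_one, map_natCast, map_ofNat, Nat.cast_add,
      Nat.cast_one, Nat.cast_ofNat] at h1 ⊢
    linear_combination h1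

/-- The (derived) Legendre differential equation. -/
lemma legendreDeriv_ode (l m : ℕ) :
    (1 - X ^ 2) * derivative (derivative (legendreDeriv l m)) -
      C (2 * ((m : ℝ) + 1)) * X * derivative (legendreDeriv l m) -
      C ((m : ℝ) * (m + 1)) * legendreDeriv l m =
      C (-((l : ℝ) * (l + 1))) * legendreDeriv l m := by
  have h := iterate_derivative_one_sub_sq_pow l (l + m)
  simp only [legendreDeriv, ← Function.iterate_succ_apply']
  simp only [map_mul, map_add, map_sub, map_one, map_natCast, map_ofNat, map_neg,
    Nat.cast_add] at h ⊢
  linear_combination h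

end Legendre

/-- Smooth complex-valued functions on `ℝ³`. -/
abbrev CTestFun : Type := {F : E3 → ℂ // ContDiff ℝ ∞ F}

namespace CTestFun

/-- The real part of a smooth function. -/
def re (F : CTestFun) : TestFun := ⟨fun p => Complex.reCLM (F.1 p), Complex.reCLM.contDiff.comp F.2⟩

/-- The imaginary part of a smooth function. -/
def im (F : CTestFun) : TestFun := ⟨fun p => Complex.imCLM (F.1 p), Complex.imCLM.contDiff.comp F.2⟩

end CTestFun

/-- The linear function `x + iy`. -/
def xiy : E3 →L[ℝ] ℂ :=
  (Complex.ofRealCLM ∘L EuclideanSpace.proj 0) +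
    Complex.I • (Complex.ofRealCLM ∘L EuclideanSpace.proj 1)

lemma xiy_apply (p : E3) : xiy p = (p 0 : ℂ) + p 1 * Complex.I := by
  simp [xiy, mul_comm]

open Polynomial in
/-- The function `q(z)`, with complex values. -/
def polyZ (q : ℝ[X]) (p : E3) : ℂ := ((q.eval (p 2) : ℝ) : ℂ)

open Polynomial in
lemma hasFDerivAt_polyZ (q : ℝ[X]) (p : E3) :
    HasFDerivAt (polyZ q)
      (Complex.ofRealCLM ∘L (q.derivative.eval (p 2) • (EuclideanSpace.proj 2 : E3 →L[ℝ] ℝ)))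
      p := by
  have h1 : HasFDerivAt (fun p : E3 => p 2) (EuclideanSpace.proj 2 : E3 →L[ℝ] ℝ) p :=
    (EuclideanSpace.proj 2 : E3 →L[ℝ] ℝ).hasFDerivAt
  have h2 : HasFDerivAt (fun p : E3 => q.eval (p 2))
      (q.derivative.eval (p 2) • (EuclideanSpace.proj 2 : E3 →L[ℝ] ℝ)) p :=
    HasDerivAt.comp_hasFDerivAt (h₂ := fun x => q.eval x) p (q.hasDerivAt (p 2)) h1
  exact Complex.ofRealCLM.hasFDerivAt.comp p h2

open Polynomial in
lemma contDiff_polyZ (q : ℝ[X]) : ContDiff ℝ ∞ (polyZ q) := by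
  have h1 : ContDiff ℝ ∞ (fun x : ℝ => q.eval x) := by
    simpa using q.contDiff_aeval (𝕜 := ℝ) ∞
  exact Complex.ofRealCLM.contDiff.comp
    (h1.comp (EuclideanSpace.proj 2 : E3 →L[ℝ] ℝ).contDiff)

open Polynomial in
/-- The function `(x + iy)ᵐ q(z)`. -/
def zonal (m : ℕ) (q : ℝ[X]) : CTestFun :=
  ⟨fun p => xiy p ^ m * polyZ q p, (xiy.contDiff.pow m).mul (contDiff_polyZ q)⟩

section Derivatives

open Polynomial

lemma rotDeriv_clm {V : Type*} [NormedAddCommGroup V] [NormedSpace ℝ V] (a : E3)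
    (T : E3 →L[ℝ] V) (p : E3) : rotDeriv a (fun p => T p) p = T (cross a p) := by
  simp [rotDeriv]

lemma fderiv_zonal (m : ℕ) (q : ℝ[X]) (p v : E3) :
    fderiv ℝ (zonal m q).1 p v =
      m * xiy p ^ (m - 1) * xiy v * polyZ q p + xiy p ^ m * (polyZ (derivative q) p * v 2) := by
  have h := (xiy.hasFDerivAt (x := p)).pow m |>.mul (hasFDerivAt_polyZ q p)
  have h' := congrArg (fun l => l v) h.fderiv
  refine Eq.trans h' ?_
  simp [polyZ]
  ring

lemma rotDeriv_pow (a : E3) (T : E3 →L[ℝ] ℂ) (n : ℕ) (p : E3) :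
    rotDeriv a (fun p => T p ^ n) p = n * T p ^ (n - 1) * T (cross a p) := by
  have h := congrArg (fun l => l (cross a p)) ((T.hasFDerivAt (x := p)).pow n).fderiv
  refine Eq.trans h ?_
  simp

lemma rotDeriv_polyZ (a : E3) (q : ℝ[X]) (p : E3) :
    rotDeriv a (polyZ q) p = polyZ (derivative q) p * cross a p 2 := by
  have h := congrArg (fun l => l (cross a p)) (hasFDerivAt_polyZ q p).fderiv
  refine Eq.trans h ?_
  simp [polyZ]

/-- The complex-valued linear function `z`. -/
def zC : E3 →L[ℝ] ℂ := Complex.ofRealCLM ∘L EuclideanSpace.proj 2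

lemma zC_apply (p : E3) : zC p = p 2 := rfl

lemma rotDeriv_zonal (a : E3) (m : ℕ) (q : ℝ[X]) (p : E3) :
    rotDeriv a (zonal m q).1 p =
      m * (xiy p ^ (m - 1) * (xiy (cross a p) * polyZ q p)) +
        xiy p ^ m * (polyZ (derivative q) p * zC (cross a p)) := by
  rw [rotDeriv, fderiv_zonal, zC_apply]
  ring

lemma rotDeriv_const_mul_add (a : E3) (c : ℂ) {F G : E3 → ℂ} (hF : ContDiff ℝ ∞ F)
    (hG : ContDiff ℝ ∞ G) (p : E3) :
    rotDeriv a (fun p => c * F p + G p) p = c * rotDeriv a F p + rotDeriv a G p := by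
  have h := (((hF.differentiable (by simp)) p).hasFDerivAt.const_mul c).add
    ((hG.differentiable (by simp)) p).hasFDerivAt
  exact congrArg (fun l => l (cross a p)) h.fderiv

lemma rotDeriv_rotDeriv_zonal (a : E3) (m : ℕ) (q : ℝ[X]) (p : E3) :
    rotDeriv a (rotDeriv a (zonal m q).1) p =
      m * (((m - 1 : ℕ) : ℂ) * xiy p ^ (m - 1 - 1) * xiy (cross a p) ^ 2 * polyZ q p +
        xiy p ^ (m - 1) * xiy (cross a (cross a p)) * polyZ q p +
        2 * xiy p ^ (m - 1) * xiy (cross a p) * polyZ (derivative q) p * zC (cross a p)) +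
      xiy p ^ m * (polyZ (derivative (derivative q)) p * zC (cross a p) ^ 2 +
        polyZ (derivative q) p * zC (cross a (cross a p))) := by
  have hx : ∀ n, ContDiff ℝ ∞ fun p => xiy p ^ n := fun n => xiy.contDiff.pow n
  have hxa : ContDiff ℝ ∞ fun p => xiy (cross a p) := (xiy ∘L crossCLM a).contDiff
  have hza : ContDiff ℝ ∞ fun p => zC (cross a p) := (zC ∘L crossCLM a).contDiff
  have e1 : rotDeriv a (zonal m q).1 = fun p =>
      m * (xiy p ^ (m - 1) * (xiy (cross a p) * polyZ q p)) +
        xiy p ^ m * (polyZ (derivative q) p * zC (cross a p)) :=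
    funext (rotDeriv_zonal a m q)
  have e2 : rotDeriv a (fun p => xiy (cross a p)) p = xiy (cross a (cross a p)) :=
    rotDeriv_clm a (xiy ∘L crossCLM a) p
  have e3 : rotDeriv a (fun p => zC (cross a p)) p = zC (cross a (cross a p)) :=
    rotDeriv_clm a (zC ∘L crossCLM a) p
  have hq := contDiff_polyZ q
  have hq' := contDiff_polyZ (derivative q)
  rw [e1, rotDeriv_const_mul_add a _ ((hx _).mul (hxa.mul hq)) ((hx _).mul (hq'.mul hza)),
    rotDeriv_mul a (hx _) (hxa.mul hq), rotDeriv_mul a hxa hq, rotDeriv_mul a (hx _) (hq'.mul hza),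
    rotDeriv_mul a hq' hza, e2, e3, rotDeriv_pow, rotDeriv_pow, rotDeriv_polyZ, rotDeriv_polyZ,
    ← zC_apply]
  ring

lemma xiy_cross (i : Fin 3) (p : E3) : xiy (cross (basisVec i) p) =
    ![-(Complex.I * zC p), zC p, Complex.I * xiy p] i := by
  fin_cases i <;>
    simp [xiy_apply, zC_apply, cross_apply_zero, cross_apply_one, basisVec_apply]
  · ring
  · linear_combination -(p 1 : ℂ) * Complex.I_sq

lemma zC_cross (i : Fin 3) (p : E3) : zC (cross (basisVec i) p) =
    ![(p 1 : ℂ), -(p 0 : ℂ), 0] i := by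
  fin_cases i <;> simp [zC_apply, cross_apply_two, basisVec_apply]

/-- On the sphere, the Laplacian maps `(x+iy)ᵐ q(z)` to
`(x+iy)ᵐ ((1-z²) q''(z) - 2(m+1) z q'(z) - m(m+1) q(z))`. -/
lemma lap_zonal (m : ℕ) (q : ℝ[X]) (p : S2) :
    lap (zonal m q).1 p = (zonal m ((1 - X ^ 2) * derivative (derivative q) -
      C (2 * ((m : ℝ) + 1)) * X * derivative q - C ((m : ℝ) * (m + 1)) * q)).1 p := by
  have hp : ((p : E3) 0 : ℂ) ^ 2 + ((p : E3) 1 : ℂ) ^ 2 + zC p ^ 2 = 1 := by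
    have h := congrArg Complex.ofReal (sq_add_sq_add_sq p)
    push_cast at h
    exact h
  have hrhs : polyZ ((1 - X ^ 2) * derivative (derivative q) -
      C (2 * ((m : ℝ) + 1)) * X * derivative q - C ((m : ℝ) * (m + 1)) * q) (p : E3) =
      (1 - zC p ^ 2) * polyZ (derivative (derivative q)) p -
        2 * (m + 1) * zC p * polyZ (derivative q) p - m * (m + 1) * polyZ q p := by
    simp [polyZ, zC_apply]
  have hx0 : xiy (p : E3) = ((p : E3) 0 : ℂ) + (p : E3) 1 * Complex.I := xiy_apply p
  have x2 : ∀ i, xiy (cross (basisVec i) (cross (basisVec i) p)) =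
      ![-(Complex.I * (p : E3) 1), -((p : E3) 0 : ℂ), -xiy p] i := by
    intro i
    rw [xiy_cross]
    fin_cases i
    · simp [zC_cross]
    · simp [zC_cross]
    · simp [xiy_cross, ← mul_assoc]
  have z2 : ∀ i, zC (cross (basisVec i) (cross (basisVec i) p)) =
      ![-zC p, -zC p, 0] i := by
    intro i
    fin_cases i <;>
    simp [zC_apply, cross_apply_two, cross_apply_one, cross_apply_zero, basisVec_apply]
  simp only [lap, Fin.sum_univ_three, rotDeriv_rotDeriv_zonal, x2, z2, xiy_cross, zC_cross]
  simp only [zonal, hrhs]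
  simp
  generalize polyZ (derivative (derivative q)) (p : E3) = q2
  generalize polyZ (derivative q) (p : E3) = q1
  generalize polyZ q (p : E3) = q0
  generalize zC (p : E3) = z at *
  generalize ((p : E3) 0 : ℂ) = x at *
  generalize ((p : E3) 1 : ℂ) = y at *
  generalize xiy (p : E3) = w at *
  have hI := Complex.I_sq
  generalize Complex.I = j at *
  rcases m with _ | _ | m
  · simp
    linear_combination q2 * hp
  · simp
    linear_combination w * q2 * hp + (q0 + 2 * z * q1) * hx0
  · simp
    linear_combination w ^ (m + 2) * q2 * hp + (m + 2) * w ^ (m + 1) * (q0 + 2 * z * q1) * hx0 +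
      (m + 2) * (m + 1) * w ^ m * (z ^ 2 + w ^ 2) * q0 * hI

end Derivatives

/-! ### Spherical harmonics -/

/-- The spherical harmonic of degree `l` and order `m ≥ 0`, without its normalizing factor. -/
def harm (l m : ℕ) : CTestFun := zonal m (legendreDeriv l m)

lemma lap_harm (l m : ℕ) (p : S2) :
    lap (harm l m).1 p = ((-((l : ℝ) * (l + 1)) : ℝ) : ℂ) * (harm l m).1 p := by
  rw [harm, lap_zonal, legendreDeriv_ode]
  simp only [zonal, polyZ, Polynomial.eval_mul, Polynomial.eval_C]
  push_cast
  ring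

lemma toL2_congr {f g : TestFun} (h : ∀ p : S2, f.1 p = g.1 p) : toL2 f = toL2 g := by
  apply Lp.ext
  filter_upwards [coeFn_toL2 f, coeFn_toL2 g] with p hf hg
  rw [hf, hg, h p]

/-- `harm l m` is an eigenfunction of the Laplacian. -/
lemma toL2_laplacian_re_harm (l m : ℕ) :
    toL2 (harm l m).re.laplacian = (-((l : ℝ) * (l + 1))) • toL2 (harm l m).re := by
  rw [← map_smul]
  refine toL2_congr fun p => ?_
  have h := congrFun (lap_clm_comp Complex.reCLM (harm l m).2) p
  refine h.trans ?_
  rw [lap_harm]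
  exact Complex.re_ofReal_mul _ _

lemma toL2_laplacian_im_harm (l m : ℕ) :
    toL2 (harm l m).im.laplacian = (-((l : ℝ) * (l + 1))) • toL2 (harm l m).im := by
  rw [← map_smul]
  refine toL2_congr fun p => ?_
  have h := congrFun (lap_clm_comp Complex.imCLM (harm l m).2) p
  refine h.trans ?_
  rw [lap_harm]
  exact Complex.im_ofReal_mul _ _

lemma rotDeriv_two_zonal (m : ℕ) (q : Polynomial ℝ) (p : E3) :
    rotDeriv (basisVec 2) (zonal m q).1 p = m * (Complex.I * (zonal m q).1 p) := by
  rw [rotDeriv_zonal, xiy_cross, zC_cross]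
  simp only [zonal]
  rcases m with _ | m
  · simp
  · simp only [pow_succ, Nat.add_sub_cancel, Nat.cast_add, Nat.cast_one, Matrix.cons_val]
    ring

lemma rot_two_re_zonal (m : ℕ) (q : Polynomial ℝ) :
    (zonal m q).re.rot 2 = (-(m : ℝ)) • (zonal m q).im := by
  apply Subtype.ext
  funext p
  have h := congrFun (rotDeriv_clm_comp Complex.reCLM (basisVec 2) (zonal m q).2) p
  refine h.trans ?_
  rw [rotDeriv_two_zonal]
  change _ = -(m : ℝ) * ((zonal m q).1 p).im
  simp [Complex.mul_re]

lemma rot_two_im_zonal (m : ℕ) (q : Polynomial ℝ) :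
    (zonal m q).im.rot 2 = (m : ℝ) • (zonal m q).re := by
  apply Subtype.ext
  funext p
  have h := congrFun (rotDeriv_clm_comp Complex.imCLM (basisVec 2) (zonal m q).2) p
  refine h.trans ?_
  rw [rotDeriv_two_zonal]
  change _ = (m : ℝ) * ((zonal m q).1 p).re
  simp [Complex.mul_im]

/-- The integral `∫ F Ψ` over the sphere. -/
def cpair (Ψ : ScalarL2) (F : CTestFun) : ℂ := ⟨⟪toL2 F.re, Ψ⟫_ℝ, ⟪toL2 F.im, Ψ⟫_ℝ⟩

lemma integrable_coeFn (Ψ : ScalarL2) : Integrable Ψ area :=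
  (Lp.memLp Ψ).integrable (by norm_num)

lemma integrable_continuous_mul {g : S2 → ℂ} (hg : Continuous g) {h : S2 → ℝ}
    (hh : Integrable h area) : Integrable (fun p => g p * (h p : ℂ)) area := by
  obtain ⟨C, hC⟩ := (isCompact_univ (X := S2)).exists_bound_of_continuousOn hg.continuousOn
  exact hh.ofReal.bdd_mul (c := C) hg.aestronglyMeasurable
    (Eventually.of_forall fun p => hC p (Set.mem_univ p))

lemma continuous_coe (F : CTestFun) : Continuous fun p : S2 => F.1 p :=
  F.2.continuous.comp continuous_subtype_val

lemma cpair_eq_integral (Ψ : ScalarL2) (F : CTestFun) :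
    cpair Ψ F = ∫ p : S2, F.1 p * ((Ψ p : ℝ) : ℂ) ∂area := by
  have hi := integrable_continuous_mul (continuous_coe F) (integrable_coeFn Ψ)
  apply Complex.ext
  · refine Eq.trans ?_ (Complex.reCLM.integral_comp_comm hi)
    simp only [cpair, inner_toL2]
    exact integral_congr_ae (Eventually.of_forall fun p => (Complex.re_mul_ofReal _ _).symm)
  · refine Eq.trans ?_ (Complex.imCLM.integral_comp_comm hi)
    simp only [cpair, inner_toL2]
    exact integral_congr_ae (Eventually.of_forall fun p => (Complex.im_mul_ofReal _ _).symm)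

/-- The normalizing factor of the spherical harmonics. -/
def harmConst (l m : ℕ) : ℝ :=
  Real.sqrt ((2 * l + 1) / (4 * Real.pi) * ((l - m).factorial / (l + m).factorial)) *
    (1 / (2 ^ l * l.factorial))

lemma sphHarmNat_eq (l m : ℕ) (p : S2) :
    sphHarmNat l m p = (harmConst l m : ℂ) * (harm l m).1 p := by
  simp only [sphHarmNat, harmConst, harm, zonal, polyZ, legendreDeriv, xiy_apply]
  push_cast
  ring

/-- As `Ψ` is real, the coefficients of orders `m` and `-m` have the same absolute value. -/
lemma enorm_coeff (Ψ : ScalarL2) (l : ℕ) (m : ℤ) :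
    ‖coeff Ψ l m‖ₑ = ‖harmConst l m.natAbs‖ₑ * ‖cpair Ψ (harm l m.natAbs)‖ₑ := by
  rw [cpair_eq_integral]
  simp only [coeff, sphHarm, sphHarmNat_eq]
  generalize m.natAbs = n
  have hconst : ‖(harmConst l n : ℂ)‖ₑ = ‖harmConst l n‖ₑ :=
    enorm_eq_iff_norm_eq.2 (Complex.norm_real _)
  split_ifs
  · have h : ∀ p : S2, (starRingEnd ℂ) ((harmConst l n : ℂ) * (harm l n).1 p) * ((Ψ p : ℝ) : ℂ) =
        (harmConst l n : ℂ) * (starRingEnd ℂ) ((harm l n).1 p * ((Ψ p : ℝ) : ℂ)) := by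
      intro p
      simp [mul_assoc]
    simp only [h]
    rw [integral_const_mul, integral_conj, enorm_mul, hconst]
    exact congrArg _ (enorm_eq_iff_norm_eq.2 (RCLike.norm_conj _))
  · have h : ∀ p : S2, (starRingEnd ℂ) ((-1) ^ n *
        (starRingEnd ℂ) ((harmConst l n : ℂ) * (harm l n).1 p)) * ((Ψ p : ℝ) : ℂ) =
        ((-1) ^ n * (harmConst l n : ℂ)) * ((harm l n).1 p * ((Ψ p : ℝ) : ℂ)) := by
      intro p
      simp [mul_assoc]
    simp only [h]
    rw [integral_const_mul, enorm_mul, enorm_mul, hconst,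
      enorm_eq_iff_norm_eq.2 (show ‖(-1 : ℂ) ^ n‖ = ‖(1 : ℂ)‖ by simp), enorm_one, one_mul]

/-! ### Completeness of the spherical harmonics -/

section Completeness

open Polynomial

lemma degree_iterate_derivative {i : ℕ} (k : ℕ) {q : ℝ[X]} (hq : q.degree = (k + i : ℕ)) :
    (derivative^[k] q).degree = i := by
  induction k generalizing q with
  | zero => simpa using hq
  | succ k ih =>
    rw [Function.iterate_succ_apply]
    have hn : q.natDegree = k + 1 + i := natDegree_eq_of_degree_eq_some hq
    refine ih ?_
    rw [degree_derivative (by omega), hn]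
    congr 1
    omega

lemma degree_legendreDeriv (m i : ℕ) : (legendreDeriv (m + i) m).degree = i := by
  apply degree_iterate_derivative
  have h : (1 - X ^ 2 : ℝ[X]).degree = 2 := by
    have : (1 - X ^ 2 : ℝ[X]) = -(X ^ 2 - C 1) := by simp
    rw [this, degree_neg, degree_X_pow_sub_C (by norm_num)]
    rfl
  rw [degree_pow, h]
  simp only [nsmul_eq_mul]
  norm_cast
  omega

/-- For fixed `m` the polynomials `legendreDeriv l m` with `l ≥ m` span all polynomials. -/
lemma span_legendreDeriv (m : ℕ) :
    Submodule.span ℝ (Set.range fun i => legendreDeriv (m + i) m) = ⊤ := by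
  let S : Polynomial.Sequence ℝ := ⟨fun i => legendreDeriv (m + i) m, degree_legendreDeriv m⟩
  refine S.span fun i => ?_
  rw [isUnit_iff_ne_zero, leadingCoeff_ne_zero]
  exact S.ne_zero i

lemma integrable_zonal_mul (m : ℕ) (q : ℝ[X]) {h : S2 → ℝ} (hh : Integrable h area) :
    Integrable (fun p : S2 => (zonal m q).1 p * (h p : ℂ)) area :=
  integrable_continuous_mul (continuous_coe _) hh

lemma integral_zonal_eq_zero {h : S2 → ℝ} (hh : Integrable h area)
    (h0 : ∀ l m : ℕ, m ≤ l → ∫ p : S2, (harm l m).1 p * (h p : ℂ) ∂area = 0) (m : ℕ) (q : ℝ[X]) :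
    ∫ p : S2, (zonal m q).1 p * (h p : ℂ) ∂area = 0 := by
  have hq : q ∈ Submodule.span ℝ (Set.range fun i => legendreDeriv (m + i) m) := by
    rw [span_legendreDeriv]
    trivial
  induction hq using Submodule.span_induction with
  | mem q hq =>
    obtain ⟨i, rfl⟩ := hq
    exact h0 (m + i) m (by omega)
  | zero => simp [zonal, polyZ]
  | add q r _ _ hq hr =>
    rw [← add_zero (0 : ℂ)]
    nth_rw 1 [← hq]
    rw [← hr, ← integral_add (integrable_zonal_mul m q hh) (integrable_zonal_mul m r hh)]
    refine integral_congr_ae (Eventually.of_forall fun p => ?_)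
    simp only [zonal, polyZ, eval_add]
    push_cast
    ring
  | smul c q _ hq =>
    rw [← mul_zero (c : ℂ), ← hq, ← integral_const_mul]
    refine integral_congr_ae (Eventually.of_forall fun p => ?_)
    simp only [zonal, polyZ, eval_smul, smul_eq_mul]
    push_cast
    ring

/-- The coordinate functions of `ℝ³` on the sphere. -/
def coordFun (i : Fin 3) : C(S2, ℝ) :=
  ⟨fun p => (p : E3) i, (EuclideanSpace.proj i : E3 →L[ℝ] ℝ).continuous.comp
    continuous_subtype_val⟩

/-- The functions orthogonal to all `(x+iy)ᵐ q(z)` are stable under multiplication by the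
coordinates. For `x` and `y` the reason is that `x-iy` maps `(x+iy)^{m+1} q(z)` to
`(x+iy)^m (1-z²) q(z)`. -/
lemma integral_zonal_coord_mul {h : S2 → ℝ} (hh : Integrable h area)
    (h0 : ∀ m q, ∫ p : S2, (zonal m q).1 p * (h p : ℂ) ∂area = 0) (i : Fin 3) (m : ℕ) (q : ℝ[X]) :
    ∫ p : S2, (zonal m q).1 p * ((coordFun i p * h p : ℝ) : ℂ) ∂area = 0 := by
  have hconj : ∫ p : S2, (starRingEnd ℂ) (xiy p) * ((zonal m q).1 p * (h p : ℂ)) ∂area = 0 := by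
    rcases m with _ | m
    · have h1 := congrArg (starRingEnd ℂ) (h0 1 q)
      rw [← integral_conj, map_zero] at h1
      rw [← h1]
      refine integral_congr_ae (Eventually.of_forall fun p => ?_)
      simp [zonal, polyZ, mul_assoc]
    · rw [← h0 m ((1 - X ^ 2) * q)]
      refine integral_congr_ae (Eventually.of_forall fun p => ?_)
      have hp : (starRingEnd ℂ) (xiy p) * xiy p = 1 - ((p : E3) 2 : ℂ) ^ 2 := by
        have h := congrArg Complex.ofReal (sq_add_sq_add_sq p)
        push_cast at h
        rw [xiy_apply]
        simp
        linear_combination h - ((p : E3) 1 : ℂ) ^ 2 * Complex.I_sq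
      simp only [zonal, polyZ, eval_mul, eval_sub, eval_one, eval_pow, eval_X]
      push_cast
      linear_combination (xiy p ^ m * ((q.eval ((p : E3) 2) : ℝ) : ℂ) * h p) * hp
  have hmul : ∫ p : S2, xiy p * ((zonal m q).1 p * (h p : ℂ)) ∂area = 0 := by
    rw [← h0 (m + 1) q]
    refine integral_congr_ae (Eventually.of_forall fun p => ?_)
    simp only [zonal]
    ring
  have hx : Continuous fun p : S2 => xiy p := xiy.continuous.comp continuous_subtype_val
  have hi1 : Integrable (fun p : S2 => (starRingEnd ℂ) (xiy p) * ((zonal m q).1 p * (h p : ℂ)))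
      area := by
    simp only [← mul_assoc]
    exact integrable_continuous_mul
      ((Complex.continuous_conj.comp hx).mul (continuous_coe (zonal m q))) hh
  have hi2 : Integrable (fun p : S2 => xiy p * ((zonal m q).1 p * (h p : ℂ))) area := by
    simp only [← mul_assoc]
    exact integrable_continuous_mul (hx.mul (continuous_coe (zonal m q))) hh
  have hlin : ∀ a b : ℂ, ∫ p : S2, (a * (xiy p * ((zonal m q).1 p * (h p : ℂ))) +
      b * ((starRingEnd ℂ) (xiy p) * ((zonal m q).1 p * (h p : ℂ)))) ∂area = 0 := by
    intro a b
    rw [integral_add (hi2.const_mul a) (hi1.const_mul b), integral_const_mul, integral_const_mul,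
      hconj, hmul]
    simp
  fin_cases i
  · rw [← hlin (1 / 2) (1 / 2)]
    refine integral_congr_ae (Eventually.of_forall fun p => ?_)
    simp [coordFun, xiy_apply]
    ring
  · rw [← hlin (-Complex.I / 2) (Complex.I / 2)]
    refine integral_congr_ae (Eventually.of_forall fun p => ?_)
    simp [coordFun, xiy_apply]
    linear_combination ((zonal m q).1 (p : E3) * ((p : E3) 1 : ℂ) * h p) * Complex.I_sq
  · rw [← h0 m (X * q)]
    refine integral_congr_ae (Eventually.of_forall fun p => ?_)
    simp [coordFun, zonal, polyZ]
    ring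

lemma integrable_continuousMap_mul (a : C(S2, ℝ)) {h : S2 → ℝ} (hh : Integrable h area) :
    Integrable (fun p => a p * h p) area := by
  obtain ⟨C, hC⟩ :=
    (isCompact_univ (X := S2)).exists_bound_of_continuousOn a.continuous.continuousOn
  exact hh.bdd_mul (c := C) a.continuous.aestronglyMeasurable
    (Eventually.of_forall fun p => hC p (Set.mem_univ p))

/-- The multipliers preserving orthogonality to all `(x+iy)ᵐ q(z)`. -/
def multipliers : Subalgebra ℝ C(S2, ℝ) where
  carrier := {a | ∀ h : S2 → ℝ, Integrable h area →
    (∀ m q, ∫ p : S2, (zonal m q).1 p * (h p : ℂ) ∂area = 0) →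
    ∀ m q, ∫ p : S2, (zonal m q).1 p * ((a p * h p : ℝ) : ℂ) ∂area = 0}
  mul_mem' {a b} ha hb h hh h0 m q := by
    rw [← ha _ (integrable_continuousMap_mul b hh) (hb h hh h0) m q]
    simp [mul_assoc]
  add_mem' {a b} ha hb h hh h0 m q := by
    rw [← add_zero (0 : ℂ)]
    nth_rw 1 [← ha h hh h0 m q]
    rw [← hb h hh h0 m q,
      ← integral_add (integrable_zonal_mul m q (integrable_continuousMap_mul a hh))
        (integrable_zonal_mul m q (integrable_continuousMap_mul b hh))]
    refine integral_congr_ae (Eventually.of_forall fun p => ?_)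
    simp
    ring
  algebraMap_mem' c h hh h0 m q := by
    rw [← mul_zero (c : ℂ), ← h0 m q, ← integral_const_mul]
    refine integral_congr_ae (Eventually.of_forall fun p => ?_)
    simp
    ring

lemma multipliers_separatesPoints : multipliers.SeparatesPoints := by
  intro p q hpq
  have : ∃ i, (p : E3) i ≠ (q : E3) i := by
    by_contra! h
    exact hpq (Subtype.ext (PiLp.ext h))
  obtain ⟨i, hi⟩ := this
  exact ⟨coordFun i, ⟨coordFun i, fun h hh h0 => integral_zonal_coord_mul hh h0 i, rfl⟩, hi⟩

/-- The spherical harmonics are complete. -/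
theorem eq_zero_of_cpair_harm (ζ : ScalarL2)
    (h0 : ∀ l m : ℕ, m ≤ l → cpair ζ (harm l m) = 0) : ζ = 0 := by
  have hζ := integrable_coeFn ζ
  have h1 : ∀ m q, ∫ p : S2, (zonal m q).1 p * ((ζ p : ℝ) : ℂ) ∂area = 0 :=
    integral_zonal_eq_zero hζ fun l m hlm => by rw [← cpair_eq_integral, h0 l m hlm]
  have hin : ∀ a : C(S2, ℝ), ⟪ContinuousMap.toLp 2 area ℝ a, ζ⟫_ℝ = ∫ p, a p * ζ p ∂area := by
    intro a
    rw [L2.inner_def]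
    refine integral_congr_ae ?_
    filter_upwards [ContinuousMap.coeFn_toLp (p := 2) (𝕜 := ℝ) area a] with p hp
    rw [hp, real_inner_eq_re_inner, RCLike.inner_apply]
    simp [mul_comm]
  have h2 : ∀ a ∈ multipliers, ⟪ContinuousMap.toLp 2 area ℝ a, ζ⟫_ℝ = 0 := by
    intro a ha
    have h := ha ζ hζ h1 0 1
    simp only [zonal, polyZ, eval_one, pow_zero, Complex.ofReal_one, one_mul] at h
    rw [integral_complex_ofReal] at h
    rw [hin]
    exact_mod_cast h
  have h3 : ∀ a : C(S2, ℝ), ⟪ContinuousMap.toLp 2 area ℝ a, ζ⟫_ℝ = 0 := by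
    intro a
    have ha := ContinuousMap.continuousMap_mem_subalgebra_closure_of_separatesPoints multipliers
      multipliers_separatesPoints a
    have hc : IsClosed {a : C(S2, ℝ) | ⟪ContinuousMap.toLp 2 area ℝ a, ζ⟫_ℝ = 0} :=
      isClosed_eq ((ContinuousMap.toLp 2 area ℝ).continuous.inner continuous_const)
        continuous_const
    exact closure_minimal h2 hc ha
  have h4 : ∀ v : ScalarL2, ⟪v, ζ⟫_ℝ = 0 := by
    intro v
    have hc : IsClosed {v : ScalarL2 | ⟪v, ζ⟫_ℝ = 0} :=
      isClosed_eq (continuous_id.inner continuous_const) continuous_const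
    have hd := ContinuousMap.toLp_denseRange ℝ area ℝ (p := 2) (by norm_num)
    have := closure_minimal (t := {v : ScalarL2 | ⟪v, ζ⟫_ℝ = 0})
      (by rintro _ ⟨a, rfl⟩; exact h3 a) hc (hd v)
    exact this
  exact inner_self_eq_zero.1 (h4 ζ)

end Completeness

/-! ### The Poincaré inequality and closed spaces of gradients -/

/-- The smooth eigenfunctions of the (weak) Laplacian for the eigenvalue `-l(l+1)`. -/
def eigenspace (l : ℕ) : Submodule ℝ TestFun where
  carrier := {f | ∀ g, ⟪gradL2 f, gradL2 g⟫_ℝ = (l : ℝ) * (l + 1) * ⟪toL2 f, toL2 g⟫_ℝ}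
  add_mem' {f f'} hf hf' g := by
    rw [map_add, map_add, inner_add_left, inner_add_left, hf g, hf' g]
    ring
  zero_mem' g := by simp
  smul_mem' c f hf g := by
    rw [map_smul, map_smul, inner_smul_left, inner_smul_left, hf g]
    simp
    ring

lemma mem_eigenspace_of_laplacian {f : TestFun} {l : ℕ}
    (h : toL2 f.laplacian = (-((l : ℝ) * (l + 1))) • toL2 f) : f ∈ eigenspace l := by
  intro g
  rw [real_inner_comm, inner_gradL2_gradL2, h, inner_smul_left]
  simp

lemma re_harm_mem_eigenspace (l m : ℕ) : (harm l m).re ∈ eigenspace l :=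
  mem_eigenspace_of_laplacian (toL2_laplacian_re_harm l m)

lemma im_harm_mem_eigenspace (l m : ℕ) : (harm l m).im ∈ eigenspace l :=
  mem_eigenspace_of_laplacian (toL2_laplacian_im_harm l m)

lemma inner_toL2_eq_zero_of_mem_eigenspace {l l' : ℕ} (hl : l ≠ l') {f f' : TestFun}
    (hf : f ∈ eigenspace l) (hf' : f' ∈ eigenspace l') : ⟪toL2 f, toL2 f'⟫_ℝ = 0 := by
  have h1 := hf f'
  have h2 := hf' f
  rw [real_inner_comm, h1, real_inner_comm] at h2
  have h3 : ((l : ℝ) - l') * (l + l' + 1) * ⟪toL2 f', toL2 f⟫_ℝ = 0 := by linear_combination h2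
  have h4 : (l : ℝ) - l' ≠ 0 := sub_ne_zero.2 (by exact_mod_cast hl)
  have h5 : (l : ℝ) + l' + 1 ≠ 0 := by positivity
  rw [real_inner_comm]
  simpa [h4, h5] using h3

lemma gradL2_one : gradL2 TestFun.one = 0 := by
  rw [Lp.eq_zero_iff_ae_eq_zero]
  filter_upwards [coeFn_gradL2 TestFun.one] with p hp
  rw [hp]
  simp [surfGrad, TestFun.one, gradient]

lemma inner_one_eq_zero_of_mem_eigenspace {l : ℕ} {f : TestFun} (hf : f ∈ eigenspace (l + 1)) :
    ⟪toL2 TestFun.one, toL2 f⟫_ℝ = 0 := by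
  have h := hf TestFun.one
  rw [gradL2_one, inner_zero_right] at h
  have h1 : ((l + 1 : ℕ) : ℝ) * (((l + 1 : ℕ) : ℝ) + 1) ≠ 0 := by positivity
  rw [real_inner_comm]
  exact (mul_eq_zero.1 h.symm).resolve_left h1

lemma re_harm_zero : (harm 0 0).re = TestFun.one := by
  apply Subtype.ext
  funext p
  simp [harm, zonal, polyZ, legendreDeriv, CTestFun.re, TestFun.one]

lemma im_harm_zero : (harm 0 0).im = 0 := by
  apply Subtype.ext
  funext p
  change ((harm 0 0).1 p).im = 0
  simp [harm, zonal, polyZ, legendreDeriv]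

/-- Functions of zero mean are limits of sums of eigenfunctions of degree at least one. -/
lemma mem_closure_eigenspaces {χ : ScalarL2} (hχ : ⟪toL2 TestFun.one, χ⟫_ℝ = 0) :
    χ ∈ ((⨆ l : ℕ, eigenspace (l + 1)).map toL2).topologicalClosure := by
  set K := ((⨆ l : ℕ, eigenspace (l + 1)).map toL2).topologicalClosure with hK
  have hmem : ∀ l f, f ∈ eigenspace (l + 1) → toL2 f ∈ K := fun l f hf =>
    Submodule.le_topologicalClosure _
      (Submodule.mem_map_of_mem ((le_iSup (fun l : ℕ => eigenspace (l + 1)) l) hf))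
  have hone : ∀ v ∈ K, ⟪toL2 TestFun.one, v⟫_ℝ = 0 := by
    intro v hv
    have hc : IsClosed {v : ScalarL2 | ⟪toL2 TestFun.one, v⟫_ℝ = 0} :=
      isClosed_eq (continuous_const.inner continuous_id) continuous_const
    refine closure_minimal ?_ hc hv
    rintro _ ⟨f, hf, rfl⟩
    refine Submodule.iSup_induction (fun l : ℕ => eigenspace (l + 1))
      (motive := fun f => ⟪toL2 TestFun.one, toL2 f⟫_ℝ = 0) hf
      (fun l f hf => inner_one_eq_zero_of_mem_eigenspace hf) (by simp) ?_
    intro f g hf hg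
    rw [map_add, inner_add_right, hf, hg, add_zero]
  have hperp : ∀ v ∈ K, ⟪v, χ - K.starProjection χ⟫_ℝ = 0 := fun v hv =>
    (Submodule.sub_starProjection_mem_orthogonal χ) v hv
  have h0 : χ - K.starProjection χ = 0 := by
    refine eq_zero_of_cpair_harm _ fun l m hlm => ?_
    rcases l with _ | l
    · obtain rfl : m = 0 := by omega
      rw [cpair, re_harm_zero, im_harm_zero, map_zero, inner_zero_left, inner_sub_right, hχ,
        hone _ (Submodule.starProjection_apply_mem K χ), sub_zero]
      rfl
    · rw [cpair, hperp _ (hmem l _ (re_harm_mem_eigenspace _ _)),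
        hperp _ (hmem l _ (im_harm_mem_eigenspace _ _))]
      rfl
  rw [sub_eq_zero.1 h0]
  exact Submodule.starProjection_apply_mem K χ

/-- The Poisson equation `-Δw = f` for finite sums of eigenfunctions of degree at least one. -/
lemma exists_poisson {f : TestFun} (hf : f ∈ ⨆ l : ℕ, eigenspace (l + 1)) :
    ∃ w, (∀ g, ⟪gradL2 w, gradL2 g⟫_ℝ = ⟪toL2 f, toL2 g⟫_ℝ) ∧ ‖gradL2 w‖ ≤ ‖toL2 f‖ := by
  obtain ⟨h, hh, rfl⟩ := (Submodule.mem_iSup_iff_exists_finsupp _ _).1 hf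
  let c : ℕ → ℝ := fun l => (((l + 1 : ℕ) : ℝ) * (((l + 1 : ℕ) : ℝ) + 1))⁻¹
  have hc0 : ∀ l : ℕ, ((l + 1 : ℕ) : ℝ) * (((l + 1 : ℕ) : ℝ) + 1) ≠ 0 := fun l => by positivity
  have hc1 : ∀ l, c l ≤ 1 := by
    intro l
    refine inv_le_one_of_one_le₀ ?_
    push_cast
    nlinarith [(Nat.cast_nonneg l : (0 : ℝ) ≤ l)]
  have hw : ∀ g, ⟪gradL2 (∑ l ∈ h.support, c l • h l), gradL2 g⟫_ℝ =
      ⟪toL2 (h.sum fun _ x => x), toL2 g⟫_ℝ := by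
    intro g
    rw [Finsupp.sum, map_sum, map_sum, sum_inner, sum_inner]
    refine Finset.sum_congr rfl fun l _ => ?_
    rw [map_smul, inner_smul_left, hh l g, ← mul_assoc]
    simp only [c, conj_trivial, inv_mul_cancel₀ (hc0 l), one_mul]
  refine ⟨∑ l ∈ h.support, c l • h l, hw, ?_⟩
  have horth : ∀ a : ℕ → ℝ, ⟪toL2 (h.sum fun _ x => x), toL2 (∑ l ∈ h.support, a l • h l)⟫_ℝ =
      ∑ l ∈ h.support, a l * ‖toL2 (h l)‖ ^ 2 := by
    intro a
    rw [Finsupp.sum, map_sum, map_sum, sum_inner]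
    refine Finset.sum_congr rfl fun l hl => ?_
    rw [inner_sum, Finset.sum_eq_single_of_mem l hl]
    · rw [map_smul, inner_smul_right, real_inner_self_eq_norm_sq]
    · intro l' _ hne
      rw [map_smul, inner_smul_right,
        inner_toL2_eq_zero_of_mem_eigenspace (by omega) (hh l) (hh l'), mul_zero]
  rw [← sq_le_sq₀ (norm_nonneg _) (norm_nonneg _), ← real_inner_self_eq_norm_sq, hw, horth]
  have h1 := horth fun _ => 1
  simp only [one_smul] at h1
  have h2 : h.sum (fun _ x => x) = ∑ l ∈ h.support, h l := rfl
  rw [← h2, real_inner_self_eq_norm_sq] at h1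
  rw [h1]
  exact Finset.sum_le_sum fun l _ => mul_le_mul_of_nonneg_right (hc1 l) (sq_nonneg _)

/-- The Poincaré inequality. -/
theorem norm_toL2_le_norm_gradL2 {f : TestFun} (hf : ⟪toL2 TestFun.one, toL2 f⟫_ℝ = 0) :
    ‖toL2 f‖ ≤ ‖gradL2 f‖ := by
  have hc : IsClosed {v : ScalarL2 | ⟪v, toL2 f⟫_ℝ ≤ ‖v‖ * ‖gradL2 f‖} :=
    isClosed_le (continuous_id.inner continuous_const) (continuous_norm.mul continuous_const)
  have key : ⟪toL2 f, toL2 f⟫_ℝ ≤ ‖toL2 f‖ * ‖gradL2 f‖ := by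
    refine closure_minimal ?_ hc (mem_closure_eigenspaces hf)
    rintro _ ⟨p, hp, rfl⟩
    obtain ⟨w, hw, hw'⟩ := exists_poisson hp
    change ⟪toL2 p, toL2 f⟫_ℝ ≤ _
    rw [← hw]
    exact (real_inner_le_norm _ _).trans (mul_le_mul_of_nonneg_right hw' (norm_nonneg _))
  rw [real_inner_self_eq_norm_mul_norm] at key
  rcases (norm_nonneg (toL2 f)).eq_or_lt with h | h
  · rw [← h]
    exact norm_nonneg _
  · exact le_of_mul_le_mul_left key h

lemma inner_one_one_ne_zero : ⟪toL2 TestFun.one, toL2 TestFun.one⟫_ℝ ≠ 0 := by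
  rw [inner_toL2_toL2]
  simp [TestFun.one, measureReal_def, ENNReal.toReal_eq_zero_iff, Real.pi_pos]

/-- The Poincaré inequality makes a sequence of functions of zero mean converge as soon as their
gradients (or rotated gradients) do. -/
lemma exists_tendsto_of_mem_closure (T : TestFun →ₗ[ℝ] FieldL2) (hT : ∀ f, ‖T f‖ = ‖gradL2 f‖)
    {g : FieldL2} (hg : g ∈ (LinearMap.range T).topologicalClosure) :
    ∃ (χ : ScalarL2) (F : ℕ → TestFun), ⟪toL2 TestFun.one, χ⟫_ℝ = 0 ∧
      Tendsto (fun n => toL2 (F n)) atTop (𝓝 χ) ∧ Tendsto (fun n => T (F n)) atTop (𝓝 g) := by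
  obtain ⟨v, hv, hvg⟩ := mem_closure_iff_seq_limit.1 hg
  choose F hF using hv
  let F' : ℕ → TestFun := fun n => F n -
    (⟪toL2 TestFun.one, toL2 (F n)⟫_ℝ / ⟪toL2 TestFun.one, toL2 TestFun.one⟫_ℝ) • TestFun.one
  have hT1 : T TestFun.one = 0 := by
    rw [← norm_eq_zero, hT, gradL2_one, norm_zero]
  have hTF : ∀ n, T (F' n) = v n := by
    intro n
    rw [map_sub, map_smul, hT1, smul_zero, sub_zero, hF]
  have hmean : ∀ n, ⟪toL2 TestFun.one, toL2 (F' n)⟫_ℝ = 0 := by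
    intro n
    rw [map_sub, map_smul, inner_sub_right, inner_smul_right,
      div_mul_cancel₀ _ inner_one_one_ne_zero, sub_self]
  have hcauchy : CauchySeq fun n => toL2 (F' n) := by
    have h1 : CauchySeq v := hvg.cauchySeq
    rw [Metric.cauchySeq_iff] at h1 ⊢
    intro ε hε
    obtain ⟨N, hN⟩ := h1 ε hε
    refine ⟨N, fun m hm n hn => lt_of_le_of_lt ?_ (hN m hm n hn)⟩
    rw [dist_eq_norm, dist_eq_norm, ← map_sub, ← hTF, ← hTF, ← map_sub, hT]
    refine norm_toL2_le_norm_gradL2 ?_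
    rw [map_sub, inner_sub_right, hmean, hmean, sub_zero]
  obtain ⟨χ, hχ⟩ := cauchySeq_tendsto_of_complete hcauchy
  refine ⟨χ, F', ?_, hχ, by simpa only [hTF] using hvg⟩
  refine tendsto_nhds_unique (tendsto_const_nhds.inner hχ) ?_
  simp [hmean]

lemma exists_hasGrad {g : FieldL2} (hg : g ∈ gradSpace) :
    ∃ χ, ⟪toL2 TestFun.one, χ⟫_ℝ = 0 ∧ HasGrad χ g := by
  obtain ⟨χ, F, h0, h1, h2⟩ := exists_tendsto_of_mem_closure gradL2 (fun _ => rfl) hg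
  exact ⟨χ, h0, (hasGrad_iff χ g).2 ⟨F, h1, h2⟩⟩

lemma exists_hasRotGrad {g : FieldL2} (hg : g ∈ rotSpace) :
    ∃ χ, ⟪toL2 TestFun.one, χ⟫_ℝ = 0 ∧ HasRotGrad χ g := by
  obtain ⟨χ, F, h0, h1, h2⟩ := exists_tendsto_of_mem_closure rotL2 norm_rotL2 hg
  exact ⟨χ, h0, (hasRotGrad_iff χ g).2 ⟨F, h1, h2⟩⟩

/-! ### The operator `L` -/

lemma aestronglyMeasurable_z_smul (u : FieldL2) :
    AEStronglyMeasurable (fun p : S2 => (p : E3) 2 • u p) area :=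
  AEStronglyMeasurable.smul
    (((EuclideanSpace.proj 2 : E3 →L[ℝ] ℝ).continuous.comp
      continuous_subtype_val).aestronglyMeasurable : AEStronglyMeasurable (fun p : S2 => (p : E3) 2)
      area) (Lp.aestronglyMeasurable u)

lemma memLp_z_smul (u : FieldL2) : MemLp (fun p : S2 => (p : E3) 2 • u p) 2 area := by
  refine (Lp.memLp u).mono (aestronglyMeasurable_z_smul u) (Eventually.of_forall fun p => ?_)
  rw [norm_smul]
  refine mul_le_of_le_one_left (norm_nonneg _) ?_
  refine (PiLp.norm_apply_le (p : E3) 2).trans ?_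
  simp

/-- The field `z u`. -/
def zField (u : FieldL2) : FieldL2 := (memLp_z_smul u).toLp

lemma inner_gradL2_zField (f : TestFun) (u : FieldL2) :
    ⟪gradL2 f, zField u⟫_ℝ = ∫ p : S2, (p : E3) 2 * ⟪u p, surfGrad f p⟫_ℝ ∂area := by
  rw [inner_gradL2]
  refine integral_congr_ae ?_
  filter_upwards [(memLp_z_smul u).coeFn_toLp] with p hp
  rw [zField, hp, inner_smul_left]
  rfl

lemma curlDist_z_perp (u : FieldL2) (f : TestFun) :
    curlDist (fun p => (p : E3) 2 • perp u p) f = -⟪gradL2 f, zField u⟫_ℝ := by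
  rw [curlDist, inner_gradL2_zField]
  congr 1
  refine integral_congr_ae (Eventually.of_forall fun p => ?_)
  change ⟪(p : E3) 2 • perp u p, surfRotGrad f p⟫_ℝ = _
  rw [inner_smul_left, surfRotGrad, inner_perp_perp _ _ _ (inner_surfGrad_self_point f p)]
  rfl

/-- The inverse Laplacian in the definition of `L[u]` exists for every square-integrable `u`: the
gradient of the solution is the orthogonal projection of `z u` to the gradients. -/
lemma exists_isInvLaplacian (u : FieldL2) :
    ∃ χ, IsInvLaplacian (curlDist fun p => (p : E3) 2 • perp u p) χ := by
  have : CompleteSpace gradSpace := (Submodule.isClosed_topologicalClosure _).completeSpace_coe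
  obtain ⟨χ, h0, hχ⟩ := exists_hasGrad (gradSpace.starProjection_apply_mem (zField u))
  refine ⟨χ, by rw [integral_eq_inner_one, h0], _, hχ, fun f => ?_⟩
  rw [curlDist_z_perp, divDist_eq_neg_inner, neg_inj, eq_comm, ← sub_eq_zero, ← inner_sub_right]
  exact Submodule.sub_starProjection_mem_orthogonal (K := gradSpace) (zField u) _
    (Submodule.le_topologicalClosure _ ⟨f, rfl⟩)

lemma HasGrad.exists_hasRotGrad {χ : ScalarL2} {g : FieldL2} (h : HasGrad χ g) :
    ∃ b, HasRotGrad χ b := by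
  obtain ⟨F, h1, h2⟩ := (hasGrad_iff χ g).1 h
  have hc : CauchySeq fun n => rotL2 (F n) := by
    have h3 := h2.cauchySeq
    rw [Metric.cauchySeq_iff] at h3 ⊢
    intro ε hε
    obtain ⟨N, hN⟩ := h3 ε hε
    refine ⟨N, fun m hm n hn => lt_of_eq_of_lt ?_ (hN m hm n hn)⟩
    rw [dist_eq_norm, dist_eq_norm, ← map_sub, ← map_sub, norm_rotL2]
  obtain ⟨b, hb⟩ := cauchySeq_tendsto_of_complete hc
  exact ⟨b, (hasRotGrad_iff χ b).2 ⟨F, h1, hb⟩⟩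

/-- `L[u]` is the rotated gradient of a stream function, and it is characterized weakly by
`∫ L[u] · ∇^⊥ f = ∫ z u · ∇f`. -/
lemma opL_spec (u : FieldL2) : ∃ χ, ⟪toL2 TestFun.one, χ⟫_ℝ = 0 ∧ HasRotGrad χ (opL u) ∧
    ∀ f, ⟪rotL2 f, opL u⟫_ℝ = ⟪gradL2 f, zField u⟫_ℝ := by
  have hex := exists_isInvLaplacian u
  have hχ : IsInvLaplacian (curlDist fun p => (p : E3) 2 • perp u p)
      (invLaplacian (curlDist fun p => (p : E3) 2 • perp u p)) := by
    rw [invLaplacian, dif_pos hex]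
    exact hex.choose_spec
  obtain ⟨h0, g, hg, hT⟩ := hχ
  have hb : HasRotGrad (invLaplacian (curlDist fun p => (p : E3) 2 • perp u p)) (opL u) := by
    have hexb := hg.exists_hasRotGrad
    rw [opL, rotGrad, dif_pos hexb]
    exact hexb.choose_spec
  refine ⟨_, by rw [← integral_eq_inner_one, h0], hb, fun f => ?_⟩
  have h1 := hT f
  rw [curlDist_z_perp, divDist_eq_neg_inner, neg_inj] at h1
  rw [hb.inner_rotL2, ← hg.inner_gradL2, h1]

lemma continuous_vert (f : TestFun) : Continuous fun p : S2 => f.1 p • basisVec 2 :=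
  (f.contDiff.continuous.comp continuous_subtype_val).smul continuous_const

/-- The class in `L²` of the vertical field `f e_z`. -/
def vertL2 (f : TestFun) : FieldL2 :=
  ContinuousMap.toLp 2 area ℝ (⟨fun p => f.1 p • basisVec 2, continuous_vert f⟩ : C(S2, E3))

lemma coeFn_vertL2 (f : TestFun) : vertL2 f =ᵐ[area] fun p : S2 => f.1 p • basisVec 2 :=
  ContinuousMap.coeFn_toLp area _

lemma inner_basisVec_two (v : E3) : ⟪v, basisVec 2⟫_ℝ = v 2 := by
  simp [inner_eq_sum, basisVec_apply]

/-- The height function `z`. -/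
def zTest : TestFun := ⟨fun p => p 2, (EuclideanSpace.proj 2 : E3 →L[ℝ] ℝ).contDiff⟩

lemma inner_surfGrad (v : E3) (f : TestFun) (p : S2) (hv : ⟪v, (p : E3)⟫_ℝ = 0) :
    ⟪v, surfGrad f p⟫_ℝ = fderiv ℝ f.1 p v := by
  rw [surfGrad, inner_sub_right, inner_smul_right, hv, mul_zero, sub_zero,
    fderiv_eq_inner_gradient, real_inner_comm]

/-- For divergence-free `u` the distribution `curl (z u^⊥) = div (z u)` is `u · ∇z`. -/
lemma inner_gradL2_zField_of_isDivFree {u : FieldL2} (hu : IsTangent u) (hd : IsDivFree u)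
    (f : TestFun) : ⟪gradL2 f, zField u⟫_ℝ = -⟪vertL2 f, u⟫_ℝ := by
  have h1 : ⟪gradL2 (zTest.mul f), u⟫_ℝ = 0 := (isDivFree_iff u).1 hd _
  rw [inner_gradL2] at h1
  have hi : Integrable (fun p : S2 => ⟪gradL2 f p, zField u p⟫_ℝ) area := L2.integrable_inner _ _
  have hi' : Integrable (fun p : S2 => ⟪vertL2 f p, u p⟫_ℝ) area := L2.integrable_inner _ _
  rw [eq_neg_iff_add_eq_zero, L2.inner_def, L2.inner_def, ← integral_add hi hi', ← h1]
  refine integral_congr_ae ?_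
  filter_upwards [hu, coeFn_vertL2 f, coeFn_gradL2 f, (memLp_z_smul u).coeFn_toLp]
    with p h2 h3 h4 h5
  have h6 := ((EuclideanSpace.proj 2 : E3 →L[ℝ] ℝ).hasFDerivAt (x := (p : E3))).mul
    (f.differentiable (p : E3)).hasFDerivAt
  have h7 : fderiv ℝ (zTest.mul f).1 (p : E3) (u p) =
      (p : E3) 2 * fderiv ℝ f.1 p (u p) + f.1 p * u p 2 :=
    congrArg (fun l => l (u p)) h6.fderiv
  rw [inner_surfGrad _ _ _ h2, h7, h3, h4, zField, h5, inner_smul_right, inner_smul_left,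
    real_inner_comm, inner_surfGrad _ _ _ h2, real_inner_comm, inner_basisVec_two]
  rfl

lemma inner_toL2_rot (i : Fin 3) (f g : TestFun) :
    ⟪toL2 f, toL2 (g.rot i)⟫_ℝ = -⟪toL2 g, toL2 (f.rot i)⟫_ℝ := by
  rw [inner_toL2_toL2, inner_toL2_toL2]
  exact integral_mul_rotDeriv i f.2 g.2

lemma inner_vertL2_rotL2 (f F : TestFun) : ⟪vertL2 f, rotL2 F⟫_ℝ = ⟪toL2 f, toL2 (F.rot 2)⟫_ℝ := by
  rw [L2.inner_def, inner_toL2_toL2]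
  refine integral_congr_ae ?_
  filter_upwards [coeFn_vertL2 f, coeFn_rotL2 F] with p h1 h2
  rw [h1, h2, inner_smul_left, real_inner_comm, inner_basisVec_two, surfRotGrad_apply]
  rfl

lemma isDivFree_of_mem_rotSpace {u : FieldL2} (hu : u ∈ rotSpace) : IsDivFree u :=
  (isDivFree_iff u).2 (inner_gradL2_of_mem_rotSpace hu)

/-- The weak form of `Δχ = D_z Ψ` for the stream functions `χ` of `L[u]` and `Ψ` of `u`. -/
lemma HasRotGrad.inner_rotL2_opL {Ψ : ScalarL2} {u : FieldL2} (h : HasRotGrad Ψ u)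
    {f : TestFun} : ⟪rotL2 f, opL u⟫_ℝ = ⟪toL2 (f.rot 2), Ψ⟫_ℝ := by
  obtain ⟨χ, -, -, hL⟩ := opL_spec u
  have hu := h.mem_rotSpace
  rw [hL, inner_gradL2_zField_of_isDivFree (isTangent_of_mem_rotSpace hu)
    (isDivFree_of_mem_rotSpace hu)]
  obtain ⟨F, h1, h2⟩ := (hasRotGrad_iff Ψ u).1 h
  refine tendsto_nhds_unique ((tendsto_const_nhds (x := vertL2 f)).inner h2).neg ?_
  refine ((tendsto_const_nhds (x := toL2 (f.rot 2))).inner h1).congr fun n => ?_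
  rw [inner_vertL2_rotL2, inner_toL2_rot, neg_neg, real_inner_comm]

/-! ### Stream functions in spherical harmonics -/

/-- The integral `∫ u · ∇^⊥ F` over the sphere. -/
def rpair (u : FieldL2) (F : CTestFun) : ℂ := ⟨⟪rotL2 F.re, u⟫_ℝ, ⟪rotL2 F.im, u⟫_ℝ⟩

lemma rpair_add (u v : FieldL2) (F : CTestFun) : rpair (u + v) F = rpair u F + rpair v F := by
  apply Complex.ext <;> simp [rpair, inner_add_right]

lemma rpair_sub (u v : FieldL2) (F : CTestFun) : rpair (u - v) F = rpair u F - rpair v F := by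
  apply Complex.ext <;> simp [rpair, inner_sub_right]

lemma HasRotGrad.rpair_harm {Ψ : ScalarL2} {u : FieldL2} (h : HasRotGrad Ψ u) (l m : ℕ) :
    rpair u (harm l m) = ((l : ℂ) * (l + 1)) * cpair Ψ (harm l m) := by
  have hc : ((l : ℂ) * (l + 1)) = (((l : ℝ) * (l + 1) : ℝ) : ℂ) := by push_cast; ring
  rw [hc]
  apply Complex.ext
  · rw [Complex.re_ofReal_mul]
    simp only [rpair, cpair]
    rw [h.inner_rotL2, toL2_laplacian_re_harm, inner_smul_left]
    simp
  · rw [Complex.im_ofReal_mul]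
    simp only [rpair, cpair]
    rw [h.inner_rotL2, toL2_laplacian_im_harm, inner_smul_left]
    simp

/-- `L` multiplies the coefficients of the stream function by `i m / (l(l+1))` (for the pairing
without complex conjugation). -/
lemma HasRotGrad.rpair_opL {Ψ : ScalarL2} {u : FieldL2} (h : HasRotGrad Ψ u) (l m : ℕ) :
    rpair (opL u) (harm l m) = m * Complex.I * cpair Ψ (harm l m) := by
  apply Complex.ext
  · simp only [rpair, cpair, harm]
    rw [h.inner_rotL2_opL, rot_two_re_zonal, map_smul, inner_smul_left]
    simp
  · simp only [rpair, cpair, harm]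
    rw [h.inner_rotL2_opL, rot_two_im_zonal, map_smul, inner_smul_left]
    simp

lemma natCast_mul_succ_ne_zero {l : ℕ} (hl : l ≠ 0) : (l : ℂ) * (l + 1) ≠ 0 :=
  mul_ne_zero (by exact_mod_cast hl) (by exact_mod_cast l.succ_ne_zero)

/-- If the coefficients of orders `m ≥ 1` of the stream function vanish, then `L[u] = 0`. -/
lemma opL_eq_zero {u : FieldL2} (hu : u ∈ rotSpace)
    (h0 : ∀ l m : ℕ, m ≠ 0 → rpair u (harm l m) = 0) : opL u = 0 := by
  obtain ⟨Ψ, -, hΨ⟩ := exists_hasRotGrad hu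
  obtain ⟨χ, hχ0, hχ, -⟩ := opL_spec u
  have hχ1 : χ = 0 := by
    refine eq_zero_of_cpair_harm χ fun l m hlm => ?_
    rcases eq_or_ne l 0 with rfl | hl
    · obtain rfl : m = 0 := by omega
      rw [cpair, re_harm_zero, im_harm_zero, map_zero, inner_zero_left, hχ0]
      rfl
    · have h1 := hχ.rpair_harm l m
      rw [hΨ.rpair_opL] at h1
      rcases eq_or_ne m 0 with rfl | hm
      · simpa [natCast_mul_succ_ne_zero hl] using h1.symm
      · have h2 := hΨ.rpair_harm l m
        rw [h0 l m hm] at h2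
        have h3 := (mul_eq_zero.1 h2.symm).resolve_left (natCast_mul_succ_ne_zero hl)
        rw [h3, mul_zero] at h1
        exact (mul_eq_zero.1 h1.symm).resolve_left (natCast_mul_succ_ne_zero hl)
  rw [hχ1] at hχ
  exact hχ.eq_zero

/-! ### The null space of `L` -/

section NullSpace

open Polynomial

/-- For `m ≥ 1` the field `i m ∇^⊥ ((x+iy)ᵐ q(z))` is the sum of the gradient of
`(x+iy)ᵐ (m z q(z) - (1-z²) q'(z))`, a vertical field and a radial field. The identity is tested
against tangent vectors `v`, which the radial field does not see; `m` is shifted by one. -/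
lemma rotGrad_zonal_identity (m : ℕ) (q : ℝ[X]) (p : S2) (v : E3) (hv : ⟪v, (p : E3)⟫_ℝ = 0) :
    ((m + 1 : ℕ) : ℂ) * Complex.I *
        ∑ k, (v k : ℂ) * rotDeriv (basisVec k) (zonal (m + 1) q).1 p =
      fderiv ℝ (zonal (m + 1) (C ((m + 1 : ℕ) : ℝ) * X * q - (1 - X ^ 2) * derivative q)).1 p v +
        (zonal (m + 1) (-(C (((m + 1 : ℕ) : ℝ) ^ 2) * q) - C ((m + 1 : ℕ) : ℝ) * X * derivative q -
          derivative (C ((m + 1 : ℕ) : ℝ) * X * q - (1 - X ^ 2) * derivative q))).1 p * v 2 := by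
  have hp : ((p : E3) 0 : ℂ) ^ 2 + ((p : E3) 1 : ℂ) ^ 2 + zC p ^ 2 = 1 := by
    have h := congrArg Complex.ofReal (sq_add_sq_add_sq p)
    push_cast at h
    exact h
  have ht : (v 0 : ℂ) * (p : E3) 0 + v 1 * (p : E3) 1 + v 2 * zC p = 0 := by
    rw [inner_eq_sum] at hv
    have h := congrArg Complex.ofReal hv
    push_cast at h
    exact h
  have hx0 : xiy (p : E3) = ((p : E3) 0 : ℂ) + (p : E3) 1 * Complex.I := xiy_apply p
  have hQ : polyZ (C ((m + 1 : ℕ) : ℝ) * X * q - (1 - X ^ 2) * derivative q) (p : E3) =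
      (m + 1) * zC p * polyZ q p - (1 - zC p ^ 2) * polyZ (derivative q) p := by
    simp [polyZ, zC_apply]
  have hH : polyZ (-(C (((m + 1 : ℕ) : ℝ) ^ 2) * q) - C ((m + 1 : ℕ) : ℝ) * X * derivative q -
        derivative (C ((m + 1 : ℕ) : ℝ) * X * q - (1 - X ^ 2) * derivative q)) (p : E3) =
      -((m + 1) ^ 2 * polyZ q p) - (m + 1) * zC p * polyZ (derivative q) p -
      polyZ (derivative (C ((m + 1 : ℕ) : ℝ) * X * q - (1 - X ^ 2) * derivative q)) p := by
    simp only [polyZ, eval_sub, eval_neg, eval_mul, eval_C, eval_X, zC_apply]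
    push_cast
    ring
  simp only [fderiv_zonal, Fin.sum_univ_three, rotDeriv_zonal, xiy_cross, zC_cross, hQ,
    xiy_apply v]
  simp only [zonal, hH]
  simp only [Matrix.cons_val, Nat.add_sub_cancel, Nat.cast_add, Nat.cast_one]
  generalize polyZ (derivative (C ((m : ℝ) + 1) * X * q - (1 - X ^ 2) * derivative q)) (p : E3) = Q'
  generalize polyZ (derivative q) (p : E3) = q1
  generalize polyZ q (p : E3) = q0
  generalize zC (p : E3) = z at *
  generalize ((p : E3) 0 : ℂ) = x at *
  generalize ((p : E3) 1 : ℂ) = y at *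
  generalize xiy (p : E3) = w at *
  generalize (v 0 : ℂ) = a at *
  generalize (v 1 : ℂ) = b at *
  generalize (v 2 : ℂ) = c at *
  have hI := Complex.I_sq
  generalize Complex.I = j at *
  linear_combination ((m : ℂ) + 1) * w ^ m * q1 * (w * ht - (a + b * j) * hp - w * y * b * hI -
    (x - y * j) * (a + b * j) * hx0 + (a + b * j) * y ^ 2 * hI) +
    ((m : ℂ) + 1) ^ 2 * w ^ m * q0 * (c * w - a * z) * hI

/-- A tangent divergence-free field without vertical component is orthogonal to the rotated
gradients of the functions of order `m ≥ 1`. -/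
lemma rpair_zonal_eq_zero {u : FieldL2} (hu : IsTangent u) (hd : IsDivFree u)
    (hv : ∀ f, ⟪vertL2 f, u⟫_ℝ = 0) (m : ℕ) (q : ℝ[X]) : rpair u (zonal (m + 1) q) = 0 := by
  set G := zonal (m + 1) (C ((m + 1 : ℕ) : ℝ) * X * q - (1 - X ^ 2) * derivative q)
  set H := zonal (m + 1)
    (-(C (((m + 1 : ℕ) : ℝ) ^ 2) * q) - C ((m + 1 : ℕ) : ℝ) * X * derivative q -
    derivative (C ((m + 1 : ℕ) : ℝ) * X * q - (1 - X ^ 2) * derivative q))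
  set E := zonal (m + 1) q
  have hm : ((m + 1 : ℕ) : ℝ) ≠ 0 := by positivity
  have hpt : ∀ (f : TestFun) (p : S2) (v : E3),
      ⟪v, surfRotGrad f p⟫_ℝ = ∑ k, v k * rotDeriv (basisVec k) f.1 p := by
    intro f p v
    rw [inner_eq_sum, Fin.sum_univ_three]
    simp only [surfRotGrad_apply]
  have hre : ∀ (F : CTestFun) (p v : E3), fderiv ℝ F.re.1 p v = (fderiv ℝ F.1 p v).re := by
    intro F p v
    have h := Complex.reCLM.hasFDerivAt.comp p ((F.2.differentiable (by simp)) p).hasFDerivAt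
    exact congrArg (fun l => l v) h.fderiv
  have him : ∀ (F : CTestFun) (p v : E3), fderiv ℝ F.im.1 p v = (fderiv ℝ F.1 p v).im := by
    intro F p v
    have h := Complex.imCLM.hasFDerivAt.comp p ((F.2.differentiable (by simp)) p).hasFDerivAt
    exact congrArg (fun l => l v) h.fderiv
  have hid : ∀ (p : S2) (v : E3), ⟪v, (p : E3)⟫_ℝ = 0 →
      ((m + 1 : ℕ) : ℂ) * Complex.I * ⟨⟪v, surfRotGrad E.re p⟫_ℝ, ⟪v, surfRotGrad E.im p⟫_ℝ⟩ =
        fderiv ℝ G.1 p v + H.1 p * v 2 := by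
    intro p v h
    rw [← rotGrad_zonal_identity m q p v h]
    congr 1
    apply Complex.ext
    · simp only [hpt, Complex.re_sum, Complex.re_ofReal_mul, rotDeriv, hre]
      rfl
    · simp only [hpt, Complex.im_sum, Complex.im_ofReal_mul, rotDeriv, him]
      rfl
  have key : ∀ f g h : TestFun, ∀ c : ℝ, (∀ (p : S2) (v : E3), ⟪v, (p : E3)⟫_ℝ = 0 →
      c * ⟪v, surfRotGrad f p⟫_ℝ = fderiv ℝ g.1 p v + h.1 p * v 2) → c ≠ 0 →
      ⟪rotL2 f, u⟫_ℝ = 0 := by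
    intro f g h c hfg hc
    have h1 : c * ⟪rotL2 f, u⟫_ℝ = ⟪gradL2 g, u⟫_ℝ + ⟪vertL2 h, u⟫_ℝ := by
      have hi : Integrable (fun p : S2 => ⟪gradL2 g p, u p⟫_ℝ) area := L2.integrable_inner _ _
      have hi' : Integrable (fun p : S2 => ⟪vertL2 h p, u p⟫_ℝ) area := L2.integrable_inner _ _
      rw [L2.inner_def, L2.inner_def, L2.inner_def, ← integral_add hi hi', ← integral_const_mul]
      refine integral_congr_ae ?_
      filter_upwards [hu, coeFn_rotL2 f, coeFn_gradL2 g, coeFn_vertL2 h] with p h1 h2 h3 h4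
      rw [h2, h3, h4, real_inner_comm, hfg p _ h1, real_inner_comm, inner_surfGrad _ _ _ h1,
        inner_smul_left, real_inner_comm, inner_basisVec_two]
      rfl
    rw [(isDivFree_iff u).1 hd, hv, add_zero] at h1
    exact (mul_eq_zero.1 h1).resolve_left hc
  apply Complex.ext
  · refine key E.re G.im H.im ((m + 1 : ℕ) : ℝ) (fun p v h => ?_) hm
    have h1 := congrArg Complex.im (hid p v h)
    rw [him]
    change _ = _ + (H.1 p).im * _
    simpa [Complex.mul_im] using h1
  · refine key E.im G.re H.re (-((m + 1 : ℕ) : ℝ)) (fun p v h => ?_) (neg_ne_zero.2 hm)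
    have h1 := congrArg Complex.re (hid p v h)
    rw [hre]
    change _ = _ + (H.1 p).re * _
    rw [neg_mul]
    simpa [Complex.mul_re] using h1

end NullSpace

lemma rpair_eq_zero_of_mem_nullL {v : FieldL2} (hv : v ∈ nullL) (m : ℕ) (q : Polynomial ℝ) :
    rpair v (zonal (m + 1) q) = 0 := by
  obtain ⟨ht, hd, hL⟩ := hv
  obtain ⟨χ, -, -, hspec⟩ := opL_spec v
  refine rpair_zonal_eq_zero ht hd (fun f => ?_) m q
  have h := hspec f
  rw [hL, inner_zero_right, inner_gradL2_zField_of_isDivFree ht hd] at h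
  linarith

/-- The closed span of the rotated gradients of the functions `(x+iy)ᵐ q(z)` with `m ≥ 1`. -/
def waveSpace : Submodule ℝ FieldL2 :=
  (Submodule.span ℝ {b | ∃ m q, b = rotL2 (zonal (m + 1) q).re ∨
    b = rotL2 (zonal (m + 1) q).im}).topologicalClosure

lemma inner_eq_zero_of_mem_waveSpace {u w : FieldL2} (hu : ∀ m q, rpair u (zonal (m + 1) q) = 0)
    (hw : w ∈ waveSpace) : ⟪w, u⟫_ℝ = 0 := by
  have hc : IsClosed {w : FieldL2 | ⟪w, u⟫_ℝ = 0} :=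
    isClosed_eq (continuous_id.inner continuous_const) continuous_const
  refine closure_minimal (fun v hv => ?_) hc hw
  change ⟪v, u⟫_ℝ = 0
  induction hv using Submodule.span_induction with
  | mem v hv =>
    obtain ⟨m, q, rfl | rfl⟩ := hv
    · exact congrArg Complex.re (hu m q)
    · exact congrArg Complex.im (hu m q)
  | zero => simp
  | add v v' _ _ hv hv' => rw [inner_add_left, hv, hv', add_zero]
  | smul c v _ hv => rw [inner_smul_left, hv, mul_zero]

lemma waveSpace_le_rotSpace : waveSpace ≤ rotSpace := by
  refine Submodule.topologicalClosure_mono (Submodule.span_le.2 ?_)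
  rintro _ ⟨m, q, rfl | rfl⟩
  exacts [⟨_, rfl⟩, ⟨_, rfl⟩]

lemma rpair_sub_starProjection_waveSpace [waveSpace.HasOrthogonalProjection] (u : FieldL2) (m : ℕ)
    (q : Polynomial ℝ) : rpair (u - waveSpace.starProjection u) (zonal (m + 1) q) = 0 := by
  have h : ∀ b ∈ waveSpace, ⟪b, u - waveSpace.starProjection u⟫_ℝ = 0 := fun b hb =>
    Submodule.sub_starProjection_mem_orthogonal (K := waveSpace) u b hb
  apply Complex.ext
  · exact h _ (Submodule.le_topologicalClosure _ (Submodule.subset_span ⟨m, q, Or.inl rfl⟩))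
  · exact h _ (Submodule.le_topologicalClosure _ (Submodule.subset_span ⟨m, q, Or.inr rfl⟩))

/-- What the projection to the wave space leaves of a rotated gradient is in the null space of
`L`: its stream function has only coefficients of order `0`. -/
lemma sub_starProjection_waveSpace_mem_nullL [waveSpace.HasOrthogonalProjection] {u : FieldL2}
    (hu : u ∈ rotSpace) : u - waveSpace.starProjection u ∈ nullL := by
  have hmem : u - waveSpace.starProjection u ∈ rotSpace :=
    sub_mem hu (waveSpace_le_rotSpace (Submodule.starProjection_apply_mem _ u))
  refine ⟨isTangent_of_mem_rotSpace hmem, isDivFree_of_mem_rotSpace hmem,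
    opL_eq_zero hmem fun l m hm => ?_⟩
  obtain ⟨m, rfl⟩ := Nat.exists_eq_succ_of_ne_zero hm
  exact rpair_sub_starProjection_waveSpace u m _

instance : waveSpace.HasOrthogonalProjection :=
  have : CompleteSpace waveSpace := (Submodule.isClosed_topologicalClosure _).completeSpace_coe
  inferInstance

/-- The projection to the null space removes exactly the part of `u` in the wave space. -/
theorem sub_projNull {u : FieldL2} (hu : u ∈ rotSpace) :
    u - projNull u = waveSpace.starProjection u := by
  have h : projNull u = u - waveSpace.starProjection u := by
    refine Submodule.eq_starProjection_of_mem_of_inner_eq_zero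
      (Submodule.le_topologicalClosure _
        (Submodule.subset_span (sub_starProjection_waveSpace_mem_nullL hu))) fun n hn => ?_
    rw [sub_sub_cancel]
    have hc : IsClosed {n : FieldL2 | ⟪waveSpace.starProjection u, n⟫_ℝ = 0} :=
      isClosed_eq (continuous_const.inner continuous_id) continuous_const
    refine closure_minimal (fun n hn => ?_) hc hn
    change ⟪waveSpace.starProjection u, n⟫_ℝ = 0
    induction hn using Submodule.span_induction with
    | mem n hn =>
      exact inner_eq_zero_of_mem_waveSpace (rpair_eq_zero_of_mem_nullL hn)
        (Submodule.starProjection_apply_mem _ u)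
    | zero => simp
    | add n n' _ _ hn hn' => rw [inner_add_right, hn, hn', add_zero]
    | smul c n _ hn => rw [inner_smul_right, hn, mul_zero]
  rw [h, sub_sub_cancel]

lemma im_zonal_zero (q : Polynomial ℝ) : (zonal 0 q).im = 0 := by
  apply Subtype.ext
  funext p
  change ((zonal 0 q).1 p).im = 0
  simp [zonal, polyZ]

/-- The wave space is orthogonal to the rotated gradients of the zonal harmonics. -/
lemma rpair_harm_zero_of_mem_waveSpace {w : FieldL2} (hw : w ∈ waveSpace) (l : ℕ) :
    rpair w (harm l 0) = 0 := by
  have him : (harm l 0).im = 0 := im_zonal_zero _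
  have hrot : (harm l 0).re.rot 2 = 0 := by
    rw [harm, rot_two_re_zonal]
    simp
  have h0 : ∀ g : TestFun, ⟪rotL2 (harm l 0).re, rotL2 (g.rot 2)⟫_ℝ = 0 := by
    intro g
    rw [inner_rotL2_rotL2, re_harm_mem_eigenspace l 0, inner_toL2_rot, hrot]
    simp
  have hre : ⟪w, rotL2 (harm l 0).re⟫_ℝ = 0 := by
    refine inner_eq_zero_of_mem_waveSpace (fun m q => ?_) hw
    have hm : ((m + 1 : ℕ) : ℝ) ≠ 0 := by positivity
    have h1 := h0 (zonal (m + 1) q).im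
    have h2 := h0 (zonal (m + 1) q).re
    rw [rot_two_im_zonal, map_smul, inner_smul_right] at h1
    rw [rot_two_re_zonal, map_smul, inner_smul_right] at h2
    apply Complex.ext
    · exact (real_inner_comm _ _).trans ((mul_eq_zero.1 h1).resolve_left hm)
    · exact (real_inner_comm _ _).trans ((mul_eq_zero.1 h2).resolve_left (neg_ne_zero.2 hm))
  apply Complex.ext
  · exact (real_inner_comm _ _).trans hre
  · simp only [rpair, him]
    simp

/-! ### Sobolev norms -/

lemma scalarNorm_mono {s t : ℝ} {Ψ χ : ScalarL2}
    (h : ∀ l m : ℕ, l ≠ 0 → (1 + (l : ℝ≥0∞)) ^ (2 * s) * ‖cpair Ψ (harm l m)‖ₑ ^ 2 ≤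
      (1 + (l : ℝ≥0∞)) ^ (2 * t) * ‖cpair χ (harm l m)‖ₑ ^ 2) :
    scalarNorm s Ψ ≤ scalarNorm t χ := by
  refine ENNReal.rpow_le_rpow (ENNReal.tsum_le_tsum fun l => Finset.sum_le_sum fun m _ => ?_)
    (by norm_num)
  rw [enorm_coeff, enorm_coeff, mul_pow, mul_pow, mul_left_comm, mul_left_comm (_ ^ (2 * t))]
  exact mul_le_mul_right (h l m.natAbs l.ne_zero) _

lemma scalarNorm_congr (s : ℝ) {Ψ χ : ScalarL2}
    (h : ∀ l m : ℕ, l ≠ 0 → cpair Ψ (harm l m) = cpair χ (harm l m)) :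
    scalarNorm s Ψ = scalarNorm s χ :=
  le_antisymm (scalarNorm_mono fun l m hl => by rw [h l m hl])
    (scalarNorm_mono fun l m hl => by rw [h l m hl])

lemma HasGrad.rpair_eq_zero {χ : ScalarL2} {g : FieldL2} (h : HasGrad χ g) (F : CTestFun) :
    rpair g F = 0 :=
  Complex.ext (h.inner_rotL2 F.re) (h.inner_rotL2 F.im)

lemma sq_rpow_half (x : ℝ≥0∞) : (x ^ 2) ^ (1 / 2 : ℝ) = x := by
  rw [← ENNReal.rpow_natCast, ← ENNReal.rpow_mul]
  norm_num

/-- The norm of a rotated gradient is that of its stream function. -/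
theorem HasRotGrad.fieldNorm_eq (s : ℝ) {Ψ : ScalarL2} {u : FieldL2} (h : HasRotGrad Ψ u)
    (h0 : ⟪toL2 TestFun.one, Ψ⟫_ℝ = 0) : fieldNorm s u = scalarNorm (s + 1) Ψ := by
  refine le_antisymm ?_ ?_
  · have hz : HasGrad 0 0 := (hasGrad_iff 0 0).2 ⟨fun _ => 0, by simp, by simp⟩
    have hH : IsHodge u 0 Ψ := by
      refine ⟨?_, ?_, 0, u, hz, h, (zero_add u).symm⟩
      · rw [integral_eq_inner_one, inner_zero_right]
      · rw [integral_eq_inner_one, h0]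
    rw [fieldNorm]
    refine (iInf_le _ (0 : ScalarL2)).trans ((iInf_le _ Ψ).trans ((iInf_le _ hH).trans ?_))
    have hs : scalarNorm (s + 1) 0 = 0 := by
      have hc : ∀ F, cpair 0 F = 0 := fun F => by
        rw [cpair, inner_zero_right, inner_zero_right]
        rfl
      simp only [scalarNorm, enorm_coeff, hc]
      simp
    rw [hs, zero_pow two_ne_zero, zero_add, sq_rpow_half]
  · refine le_iInf fun Φ' => le_iInf fun Ψ' => le_iInf fun hH => ?_
    obtain ⟨-, -, a, b, ha, hb, hab⟩ := hH
    have he : scalarNorm (s + 1) Ψ = scalarNorm (s + 1) Ψ' := by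
      refine scalarNorm_congr _ fun l m hl => ?_
      have h1 := h.rpair_harm l m
      rw [hab, rpair_add, ha.rpair_eq_zero, zero_add, hb.rpair_harm] at h1
      exact (mul_left_cancel₀ (natCast_mul_succ_ne_zero hl) h1).symm
    rw [he]
    nth_rw 1 [← sq_rpow_half (scalarNorm (s + 1) Ψ')]
    exact ENNReal.rpow_le_rpow le_add_self (by norm_num)

/-- A divergence-free field with a Hodge decomposition is a rotated gradient. -/
lemma mem_rotSpace_of_fieldNorm_lt_top {s : ℝ} {u : FieldL2} (hd : IsDivFree u)
    (hu : fieldNorm s u < ⊤) : u ∈ rotSpace := by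
  have hex : ∃ Φ Ψ, IsHodge u Φ Ψ := by
    by_contra! hne
    refine hu.ne ?_
    simp [fieldNorm, hne]
  obtain ⟨Φ, Ψ, -, -, a, b, ha, hb, hab⟩ := hex
  have ha0 : a = 0 := by
    refine eq_zero_of_mem_gradSpace ha.mem_gradSpace fun f => ?_
    have h1 := (isDivFree_iff u).1 hd f
    rwa [hab, inner_add_right, inner_gradL2_of_mem_rotSpace hb.mem_rotSpace, add_zero] at h1
  rw [hab, ha0, zero_add]
  exact hb.mem_rotSpace

/-- The elementary inequality behind the estimate: if `l(l+1) c = i m d` with `m ≥ 1`, then `c` is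
at most two powers of `1 + l` smaller than `d`. -/
lemma weight_mul_enorm_le {l m : ℕ} (hm : m ≠ 0) (s : ℝ) {c d : ℂ}
    (h : (l : ℂ) * (l + 1) * c = m * Complex.I * d) :
    (1 + (l : ℝ≥0∞)) ^ (2 * s) * ‖d‖ₑ ^ 2 ≤ (1 + (l : ℝ≥0∞)) ^ (2 * (s + 2)) * ‖c‖ₑ ^ 2 := by
  have h1 : ‖d‖ ≤ (1 + (l : ℝ)) ^ 2 * ‖c‖ := by
    have h2 := congrArg norm h
    have h3 : ‖(l : ℂ) + 1‖ = (l : ℝ) + 1 := by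
      have := Complex.norm_natCast (l + 1)
      push_cast at this
      exact this
    simp only [norm_mul, Complex.norm_natCast, Complex.norm_I, mul_one, h3] at h2
    have h4 : (1 : ℝ) ≤ m := by exact_mod_cast Nat.one_le_iff_ne_zero.2 hm
    have h5 : (0 : ℝ) ≤ l := Nat.cast_nonneg l
    calc ‖d‖ ≤ m * ‖d‖ := le_mul_of_one_le_left (norm_nonneg _) h4
      _ = l * (l + 1) * ‖c‖ := h2.symm
      _ ≤ (1 + (l : ℝ)) ^ 2 * ‖c‖ :=
        mul_le_mul_of_nonneg_right (by nlinarith) (norm_nonneg _)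
  have h2 : ‖d‖ₑ ≤ (1 + (l : ℝ≥0∞)) ^ 2 * ‖c‖ₑ := by
    have h3 := ENNReal.ofReal_le_ofReal h1
    rw [ENNReal.ofReal_mul (by positivity), ofReal_norm, ofReal_norm,
      ENNReal.ofReal_pow (by positivity), ENNReal.ofReal_add zero_le_one (by positivity),
      ENNReal.ofReal_one, ENNReal.ofReal_natCast] at h3
    exact h3
  have hne : (1 + (l : ℝ≥0∞)) ≠ 0 := by simp
  have hnt : (1 + (l : ℝ≥0∞)) ≠ ⊤ := by simp
  have hw : (1 + (l : ℝ≥0∞)) ^ (2 * (s + 2)) =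
      (1 + (l : ℝ≥0∞)) ^ (2 * s) * (1 + (l : ℝ≥0∞)) ^ 4 := by
    rw [show 2 * (s + 2) = 2 * s + ((4 : ℕ) : ℝ) by push_cast; ring,
      ENNReal.rpow_add _ _ hne hnt, ENNReal.rpow_natCast]
  rw [hw, mul_assoc]
  refine mul_le_mul_right ?_ _
  calc ‖d‖ₑ ^ 2 ≤ ((1 + (l : ℝ≥0∞)) ^ 2 * ‖c‖ₑ) ^ 2 := pow_le_pow_left' h2 2
    _ = (1 + (l : ℝ≥0∞)) ^ 4 * ‖c‖ₑ ^ 2 := by ring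

/-- The estimate and the identity for divergence-free fields with a Hodge decomposition. The three
norms are those of the stream functions `Ψ₁`, `χ₁`, `χ` of `u - Πu`, `L[u - Πu]` and `L[u]`, which
are compared coefficient by coefficient. -/
theorem fieldNorm_sub_projNull_le (k : ℝ) {u : FieldL2} (hd : IsDivFree u)
    (hu : fieldNorm k u < ⊤) :
    fieldNorm k (u - projNull u) ≤ fieldNorm (k + 2) (opL (u - projNull u)) ∧
      fieldNorm (k + 2) (opL (u - projNull u)) = fieldNorm (k + 2) (opL u) := by
  have hrot := mem_rotSpace_of_fieldNorm_lt_top hd hu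
  rw [sub_projNull hrot]
  set w := waveSpace.starProjection u
  have hw : w ∈ waveSpace := Submodule.starProjection_apply_mem _ u
  obtain ⟨Ψ, -, hΨ⟩ := exists_hasRotGrad hrot
  obtain ⟨Ψ₁, hΨ₁0, hΨ₁⟩ := exists_hasRotGrad (waveSpace_le_rotSpace hw)
  obtain ⟨χ, hχ0, hχ, -⟩ := opL_spec u
  obtain ⟨χ₁, hχ₁0, hχ₁, -⟩ := opL_spec w
  -- the zonal coefficients of `Ψ₁` vanish, the others are those of `Ψ`
  have hzero : ∀ l : ℕ, l ≠ 0 → cpair Ψ₁ (harm l 0) = 0 := by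
    intro l hl
    have h := hΨ₁.rpair_harm l 0
    rw [rpair_harm_zero_of_mem_waveSpace hw] at h
    exact (mul_eq_zero.1 h.symm).resolve_left (natCast_mul_succ_ne_zero hl)
  have heq : ∀ l m : ℕ, l ≠ 0 → cpair Ψ₁ (harm l (m + 1)) = cpair Ψ (harm l (m + 1)) := by
    intro l m hl
    have h : rpair (u - w) (harm l (m + 1)) = 0 := rpair_sub_starProjection_waveSpace u m _
    rw [rpair_sub, hΨ.rpair_harm, hΨ₁.rpair_harm, ← mul_sub] at h
    exact (sub_eq_zero.1 ((mul_eq_zero.1 h).resolve_left (natCast_mul_succ_ne_zero hl))).symm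
  have hL : ∀ l m : ℕ, (l : ℂ) * (l + 1) * cpair χ (harm l m) =
      m * Complex.I * cpair Ψ (harm l m) := fun l m => by
    rw [← hχ.rpair_harm, hΨ.rpair_opL]
  have hL₁ : ∀ l m : ℕ, (l : ℂ) * (l + 1) * cpair χ₁ (harm l m) =
      m * Complex.I * cpair Ψ₁ (harm l m) := fun l m => by
    rw [← hχ₁.rpair_harm, hΨ₁.rpair_opL]
  rw [hΨ₁.fieldNorm_eq k hΨ₁0, hχ₁.fieldNorm_eq (k + 2) hχ₁0, hχ.fieldNorm_eq (k + 2) hχ0]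
  constructor
  · refine scalarNorm_mono fun l m hl => ?_
    rcases m with _ | m
    · rw [hzero l hl]
      simp
    · rw [add_right_comm]
      exact weight_mul_enorm_le m.succ_ne_zero (k + 1) (hL₁ l (m + 1))
  · refine scalarNorm_congr _ fun l m hl => ?_
    refine mul_left_cancel₀ (natCast_mul_succ_ne_zero hl) ?_
    rw [hL, hL₁]
    rcases m with _ | m
    · simp
    · rw [heq l m hl]

end SphereFlow

end

theorem theorem4 (k : ℝ) (hk : 0 ≤ k) (u : SphereFlow.FieldL2)
    (hu_tan : SphereFlow.IsTangent u) (hu_div : SphereFlow.IsDivFree u)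
    (hu : SphereFlow.fieldNorm k u < ⊤) :
    SphereFlow.fieldNorm k (u - SphereFlow.projNull u) ≤
        SphereFlow.fieldNorm (k + 2) (SphereFlow.opL (u - SphereFlow.projNull u)) ∧
      SphereFlow.fieldNorm (k + 2) (SphereFlow.opL (u - SphereFlow.projNull u)) =
        SphereFlow.fieldNorm (k + 2) (SphereFlow.opL u) :=
  SphereFlow.fieldNorm_sub_projNull_le k hu_div hu
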